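/- **Theorem (Real-analytic untwisted AbC diffeomorphisms).** *Notation.* Let $\mathbb T^2=\mathbb R^2/\mathbb Z^2$ with Lebesgue measure $\mu$, and let $R^t(x_1,x_2)=(x_1+t,x_2)$. For $N,s\ge 1$ let $\xi_N^s$ be the partition of $\mathbb T^2$ into the rectangles $[\frac iN,\frac{i+1}N)\times[\frac js,\frac{j+1}s)$, $0\le i<N$, $0\le j<s$. A *permutation of $\xi_N^s$* is a bijection of $\mathbb T^2$ that maps each atom of $\xi_N^s$ by a translation onto an atom of $\xi_N^s$. For $\rho>0$ let $\Omega_\rho=\{(z_1,z_2)\in\mathbb C^2:|\operatorname{Im}z_1|<\rho,\ |\operatorname{Im}z_2|<\rho\}$ and $\|f\|_\rho=\sup_{\Omega_\rho}|f|$. Let $C^\omega_\rho(\mathbb T^2)$ be the set of $\mathbb Z^2$-periodic functions $\mathbb R^2\to\mathbb R$ that extend holomorphically to $\Omega_\rho$ with $\|f\|_\rho<\infty$. Let $\mathrm{Diff}^\omega_\rho(\mathbb T^2,\mu)$ be the set of $\mu$-preserving homeomorphisms $f$ of $\mathbb T^2$ such that both $f$ and $f^{-1}$ have lifts to $\mathbb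 R^2$ of the form $(x_1+f_1(x),x_2+f_2(x))$ with $f_1,f_2\in C^\omega_\rho(\mathbb T^2)$ (these are the real-analytic $\mu$-preserving diffeomorphisms homotopic to the identity that, together with their inverses, extend to the band). Put $$d_\rho(f,g)=\max\{\tilde d_\rho(f,g),\tilde d_\rho(f^{-1},g^{-1})\},\qquad \tilde d_\rho(f,g)=\max_{i=1,2}\inf_{n\in\mathbb Z}\|f_i-g_i+n\|_\rho ,$$ and $\mathrm{Diff}^\omega_\infty(\mathbb T^2,\mu)=\bigcap_{n\ge1}\mathrm{Diff}^\omega_n(\mathbb T^2,\mu)$. *Abstract untwisted AbC method.* Let $(k_n)_{n\ge0},(l_n)_{n\ge0}$ be sequences of positive integers. An abstract untwisted AbC construction with parameters $k_n,l_n$ consists of natural numbers $p_n,q_n,s_n$ with $q_0,s_n\geq 1$, $\gcd(p_0,q_0)=1$, $$p_{n+1}=p_nq_nk_nl_n+1,\qquad q_{n+1}=k_nl_nq_n^2,\qquad s_{n+1}\le s_n^{k_n}\qquad(n\ge0),$$ and of permutations $h_{n+1}$ of $\xi_{k_nq_n}^{s_{n+1}}$ ($n\ge0$) that commute with $R^{1/q_n}$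 and leave $[0,1/q_n)\times\mathbb T^1$ invariant. Put $\alpha_n=p_n/q_n$, $H_n=h_n\circ\dots\circ h_1$ and $T_n=H_n^{-1}\circ R^{\alpha_n}\circ H_n$. A measure preserving transformation $T$ of $(\mathbb T^2,\mu)$ is *built* by this construction if $T_n\to T$ in the weak topology, i.e. $\mu(T_n^{-1}B\,\triangle\,T^{-1}B)\to0$ for every measurable $B$. *Claim.* Fix $\rho>0$ and a summable sequence of positive numbers $(\varepsilon_n)$. There are functions $l_n^*=l_n^*(k_0,\dots,k_n,l_0,\dots,l_{n-1})\in\mathbb N$, $n\ge0$ (depending only on $\rho$, on $(\varepsilon_n)$ and on the indicated parameters), such that the following holds for all sequences $(k_n),(l_n)$ of positive integers with $l_n\ge l_n^*(k_0,\dots,k_n,l_0,\dots,l_{n-1})$ for all $n$. Let $T$ be a measure preserving transformation of $\mathbb T^2$ built by an abstract untwisted AbC construction with parameters $k_n,l_n$. Then there are $h_n^{(\mathfrak a)}\in\mathrm{Diff}^\omega_\infty(\mathbb T^2,\mu)$, $n\ge1$, and $T^{(\mathfrak a)}\in\mathrm{Diff}^\omega_\rho(\mathbb T^2,\mu)$ such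 that 1. $h_{n+1}^{(\mathfrak a)}$ $\varepsilon_{n+1}$-approximates $h_{n+1}$ for every $n\ge0$: it commutes with $R^{1/q_n}$, and there is a measurable set $L$ with $\mu(L)>1-\varepsilon_{n+1}$ and $h_{n+1}^{(\mathfrak a)}(L\cap R)\subset h_{n+1}(R)$ for every $R\in\xi_{k_nq_n}^{s_{n+1}}$; 2. with $H_n^{(\mathfrak a)}=h_n^{(\mathfrak a)}\circ\dots\circ h_1^{(\mathfrak a)}$, the maps $T_n^{(\mathfrak a)}=(H_n^{(\mathfrak a)})^{-1}\circ R^{\alpha_n}\circ H_n^{(\mathfrak a)}$ belong to $\mathrm{Diff}^\omega_\rho(\mathbb T^2,\mu)$, and $d_\rho(T_n^{(\mathfrak a)},T^{(\mathfrak a)})\to0$; 3. $T^{(\mathfrak a)}$ is measure theoretically isomorphic to $T$. -/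

import Mathlib

open MeasureTheory Filter Topology
open scoped symmDiff ENNReal

noncomputable section

/-- The torus `ℝ² / ℤ²`; its `volume` is the normalized Lebesgue measure. -/
abbrev Torus : Type := UnitAddCircle × UnitAddCircle

/-! ### Real-analytic diffeomorphisms of the torus -/

/-- The complex band of width `ρ` around `ℝ²` in `ℂ²`. -/
def band (ρ : ℝ) : Set (ℂ × ℂ) := {z | |z.1.im| < ρ ∧ |z.2.im| < ρ}

/-- The supremum norm over the band (with values in `[0, ∞]`). -/
def bandNorm (ρ : ℝ) (f : ℂ × ℂ → ℂ) : ℝ≥0∞ := ⨆ z ∈ band ρ, ‖f z‖ₑ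

/-- `f` is (on the band) the complexification of an element of `C^ω_ρ(𝕋²)`: it is holomorphic and
bounded on the band, and its restriction to `ℝ²` is real valued and `ℤ²`-periodic. -/
structure IsCOmega (ρ : ℝ) (f : ℂ × ℂ → ℂ) : Prop where
  holomorphic : DifferentiableOn ℂ f (band ρ)
  bounded : bandNorm ρ f < ⊤
  real : ∀ x y : ℝ, (f ((x : ℂ), (y : ℂ))).im = 0
  periodic : ∀ (x y : ℝ) (m n : ℤ),
    f (((x + m : ℝ) : ℂ), ((y + n : ℝ) : ℂ)) = f ((x : ℂ), (y : ℂ))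

/-- The map `F(x₁, x₂) = (x₁ + f₁(x₁, x₂), x₂ + f₂(x₁, x₂))`, with `f₁, f₂` in `C^ω_ρ(𝕋²)`,
is a lift of `f` to `ℝ²`. -/
structure IsAnalyticLift (ρ : ℝ) (f : Torus → Torus) (f₁ f₂ : ℂ × ℂ → ℂ) : Prop where
  fst_mem : IsCOmega ρ f₁
  snd_mem : IsCOmega ρ f₂
  lift : ∀ x y : ℝ, f ((x : UnitAddCircle), (y : UnitAddCircle)) =
    (((x + (f₁ ((x : ℂ), (y : ℂ))).re : ℝ) : UnitAddCircle),
      ((y + (f₂ ((x : ℂ), (y : ℂ))).re : ℝ) : UnitAddCircle))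

/-- `Diff^ω_ρ(𝕋², μ)`. Having a lift of the form `id + periodic` says that the map is
homotopic to the identity. -/
def DiffOmega (ρ : ℝ) : Set (Torus ≃ₜ Torus) :=
  {f | MeasurePreserving (f : Torus → Torus) volume volume ∧
    (∃ f₁ f₂, IsAnalyticLift ρ f f₁ f₂) ∧ (∃ g₁ g₂, IsAnalyticLift ρ f.symm g₁ g₂)}

/-- `Diff^ω_∞(𝕋², μ)`, the intersection of `Diff^ω_n(𝕋², μ)` over `n = 1, 2, 3, …`. -/
def DiffOmegaInfty : Set (Torus ≃ₜ Torus) := ⋂ n : ℕ, DiffOmega ((n : ℝ) + 1)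

/-- `max_i inf_{n ∈ ℤ} ‖f_i - g_i + n‖_ρ`, where `id + (f₁, f₂)` and `id + (g₁, g₂)` are lifts of
`f` and `g`. The complexified lifts are unique on the band up to additive integers, so the infima
over the lifts only express that any lifts may be used (the value is `∞` if there is no lift). -/
def dTilde (ρ : ℝ) (f g : Torus → Torus) : ℝ≥0∞ :=
  ⨅ (f₁ : ℂ × ℂ → ℂ) (f₂ : ℂ × ℂ → ℂ) (_ : IsAnalyticLift ρ f f₁ f₂)
    (g₁ : ℂ × ℂ → ℂ) (g₂ : ℂ × ℂ → ℂ) (_ : IsAnalyticLift ρ g g₁ g₂),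
    max (⨅ n : ℤ, bandNorm ρ (fun z => f₁ z - g₁ z + n))
      (⨅ n : ℤ, bandNorm ρ (fun z => f₂ z - g₂ z + n))

/-- The metric `d_ρ` of `Diff^ω_ρ(𝕋², μ)`. -/
def dRho (ρ : ℝ) (f g : Torus ≃ₜ Torus) : ℝ≥0∞ :=
  max (dTilde ρ f g) (dTilde ρ f.symm g.symm)

/-! ### The abstract untwisted AbC method -/

/-- The circle action `R^t (x₁, x₂) = (x₁ + t, x₂)`. -/
def rot (t : ℝ) : Torus ≃ₜ Torus := Homeomorph.addRight ((t : UnitAddCircle), (0 : UnitAddCircle))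

/-- The atom `[i/N, (i+1)/N) × [j/s, (j+1)/s)`, `c = (i, j)`, of the partition of the torus
into `N * s` rectangles. -/
def cell (N s : ℕ) (c : Fin N × Fin s) : Set Torus :=
  {x | ∃ u ∈ Set.Ico ((c.1 : ℝ) / N) (((c.1 : ℝ) + 1) / N),
    ∃ v ∈ Set.Ico ((c.2 : ℝ) / s) (((c.2 : ℝ) + 1) / s),
      x = ((u : UnitAddCircle), (v : UnitAddCircle))}

/-- `h` permutes the atoms of the partition into `N * s` rectangles, by translating each atom
onto its image. -/
def IsGridPermutation (N s : ℕ) (h : Equiv.Perm Torus) : Prop :=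
  ∃ σ : Equiv.Perm (Fin N × Fin s), ∀ c : Fin N × Fin s, ∀ x ∈ cell N s c,
    h x = x + (((((σ c).1 : ℝ) / N - (c.1 : ℝ) / N : ℝ) : UnitAddCircle),
      ((((σ c).2 : ℝ) / s - (c.2 : ℝ) / s : ℝ) : UnitAddCircle))

/-- The vertical strip `[0, 1/q) × 𝕋¹`. -/
def strip (q : ℕ) : Set Torus :=
  {x | ∃ u ∈ Set.Ico (0 : ℝ) (1 / q), x.1 = (u : UnitAddCircle)}

/-- `h_n ∘ ⋯ ∘ h_1` (the entry `h 0` is not used). -/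
def composite {G : Type*} [Group G] (h : ℕ → G) : ℕ → G
  | 0 => 1
  | n + 1 => h (n + 1) * composite h n

/-- The data of an abstract untwisted AbC construction with parameters `k_n`, `l_n`. -/
structure UntwistedAbC (k l : ℕ → ℕ) where
  p : ℕ → ℕ
  q : ℕ → ℕ
  s : ℕ → ℕ
  h : ℕ → Equiv.Perm Torus
  k_pos : ∀ n, 0 < k n
  l_pos : ∀ n, 0 < l n
  s_pos : ∀ n, 0 < s n
  q_zero_pos : 0 < q 0
  coprime_zero : Nat.Coprime (p 0) (q 0)
  p_succ : ∀ n, p (n + 1) = p n * q n * k n * l n + 1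
  q_succ : ∀ n, q (n + 1) = k n * l n * q n ^ 2
  s_succ_le : ∀ n, s (n + 1) ≤ s n ^ k n
  h_grid : ∀ n, IsGridPermutation (k n * q n) (s (n + 1)) (h (n + 1))
  h_comm : ∀ n x, h (n + 1) (rot (1 / q n) x) = rot (1 / q n) (h (n + 1) x)
  h_untwisted : ∀ n, h (n + 1) '' strip (q n) = strip (q n)

/-- `α_n = p_n / q_n`. -/
def UntwistedAbC.α {k l : ℕ → ℕ} (A : UntwistedAbC k l) (n : ℕ) : ℝ := (A.p n : ℝ) / A.q n

/-- `T_n = H_n⁻¹ ∘ R^{α_n} ∘ H_n` with `H_n = h_n ∘ ⋯ ∘ h_1`. -/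
def UntwistedAbC.T {k l : ℕ → ℕ} (A : UntwistedAbC k l) (n : ℕ) : Equiv.Perm Torus :=
  (composite A.h n)⁻¹ * (rot (A.α n)).toEquiv * composite A.h n

/-- Convergence in the weak topology of measure preserving transformations. For invertible
transformations, preimages may equivalently be replaced by images. -/
def WeaklyTendsto (S : ℕ → Torus → Torus) (T : Torus → Torus) : Prop :=
  ∀ B : Set Torus, MeasurableSet B →
    Tendsto (fun n => volume ((S n ⁻¹' B) ∆ (T ⁻¹' B))) atTop (𝓝 0)

/-- `T` is a measure preserving transformation built by the abstract untwisted AbC construction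
`A`: it is the weak limit of the `T_n`. -/
def UntwistedAbC.Builds {k l : ℕ → ℕ} (A : UntwistedAbC k l) (T : Torus → Torus) : Prop :=
  MeasurePreserving T volume volume ∧ WeaklyTendsto (fun n => A.T n) T

/-! ### Approximation and isomorphism -/

/-- `g` maps, up to a set of measure less than `ε`, each atom of the partition into `N * s`
rectangles into the image of that atom under `h`, and `g` commutes with `R^{1/q}`. -/
def EpsApproximates (ε : ℝ) (N s q : ℕ) (g : Torus ≃ₜ Torus) (h : Equiv.Perm Torus) : Prop :=
  (∃ L : Set Torus, MeasurableSet L ∧ 1 - ε < volume.real L ∧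
    ∀ c : Fin N × Fin s, ∀ x ∈ L ∩ cell N s c, g x ∈ h '' cell N s c) ∧
  ∀ x, g (rot (1 / q) x) = rot (1 / q) (g x)

/-- Measure theoretic isomorphism of two transformations of the torus: there is a measure
preserving map, invertible modulo null sets with measure preserving inverse, conjugating them. -/
def MeasureIsomorphic (T S : Torus → Torus) : Prop :=
  ∃ φ ψ : Torus → Torus,
    MeasurePreserving φ volume volume ∧ MeasurePreserving ψ volume volume ∧
    (∀ᵐ x : Torus, ψ (φ x) = x) ∧ (∀ᵐ y : Torus, φ (ψ y) = y) ∧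
    ∀ᵐ x : Torus, φ (T x) = S (φ x)

end

noncomputable section

/-! ### Weak convergence of measure preserving maps -/

/-! Write $G_n$ for the composites of the approximating diffeomorphisms $g_n$ and $S_n = G_n^{-1}
R^{\alpha_n} G_n$.

Approximation. Each $h_{n+1}$ is a weak limit of volume preserving diffeomorphisms with entire lifts
that commute with $R^{1/q_n}$ (`IsGridPermutation.mem_approxGroup`). Shears by trigonometric
polynomials, taken in $q_n x_1$ when the shear is vertical, are such diffeomorphisms, and step
functions are limits in measure of trigonometric polynomials. So shears that move measurable sets of
rows or $1/q_n$-periodic sets of columns are weak limits. A commutator of two of these cycles three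
rectangles. Two such 3-cycles with two rectangles in common multiply to a pair of disjoint
transpositions, which is the exchange of two cells once each is cut into halves. Such exchanges
generate all permutations of the cells.

Isomorphism. By `exists_isApproximant`, $g_{n+1}$ can be taken so close to $h_{n+1}$ that
$G_n^{-1}H_n$ and $H_n^{-1}G_n$ move by less than $2^{-n}$ outside sets of measure at most $2^{-n}$.
By Borel–Cantelli both converge almost everywhere. Passing to the limit in
$(H_n^{-1}G_n)(G_n^{-1}H_n)=\mathrm{id}$ and $(G_n^{-1}H_n)T_n = S_n(G_n^{-1}H_n)$ gives the
isomorphism (`measureIsomorphic_of_conj`).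

Analytic convergence. As $g_{n+1}$ commutes with $R^{\alpha_n}$, both $S_n$ and $S_{n+1}$ are
conjugates by $G_{n+1}$ of rotations whose angles differ by $1/(k_nl_nq_n^2)\le 1/l_n$. A Schwarz
estimate bounds their distance by $C/l_n$, with $C$ depending on $G_{n+1}$ but not on the angle
(`exists_conj_rot_liftsWithin`).

Uniformity of $l_n^*$. It may depend on the parameters only, while $C$ depends on the construction.
The approximants are therefore a fixed choice function of the data of a stage, so that for given
parameters and bounded $q_0,s_0$ only finitely many $G_{n+1}$ occur (`finite_stages`,
`finite_nextStages`). As $q_0,s_0$ have no a priori bound, $l_n^*$ serves the constructions with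
$q_0,s_0\le n$; each construction is controlled from some index on, which suffices for convergence.
-/

instance instIsProbabilityMeasureUnitAddCircle :
    IsProbabilityMeasure (volume : Measure UnitAddCircle) :=
  ⟨by simp⟩

instance instIsAddHaarMeasureUnitAddCircle :
    (volume : Measure UnitAddCircle).IsAddHaarMeasure :=
  inferInstanceAs ((volume : Measure (AddCircle (1 : ℝ))).IsAddHaarMeasure)

instance instIsProbabilityMeasureTorus : IsProbabilityMeasure (volume : Measure Torus) :=
  inferInstanceAs (IsProbabilityMeasure ((volume : Measure UnitAddCircle).prod volume))

instance instIsAddHaarMeasureTorus : (volume : Measure Torus).IsAddHaarMeasure :=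
  inferInstanceAs (((volume : Measure UnitAddCircle).prod volume).IsAddHaarMeasure)

/-- Maps of the torus that preserve Lebesgue measure. -/
abbrev PreservesVolume (f : Torus → Torus) : Prop := MeasurePreserving f volume volume

/-- Interpolate with $f \circ G_n$. The first error is pulled back by the measure preserving $G_n$,
so it equals the error of $F_n$ on $B$; the second is that of $G_n$ on $f^{-1}B$. -/
theorem WeaklyTendsto.comp {F G : ℕ → Torus → Torus} {f g : Torus → Torus}
    (hF : WeaklyTendsto F f) (hG : WeaklyTendsto G g) (mF : ∀ n, Measurable (F n))
    (mf : Measurable f) (pG : ∀ n, PreservesVolume (G n)) :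
    WeaklyTendsto (fun n => F n ∘ G n) (f ∘ g) := by
  intro B hB
  have h := (hF B hB).add (hG _ (mf hB))
  rw [add_zero] at h
  refine tendsto_of_tendsto_of_tendsto_of_le_of_le tendsto_const_nhds h (fun _ => zero_le) ?_
  intro n
  refine (measure_symmDiff_le _ ((f ∘ G n) ⁻¹' B) _).trans (add_le_add (le_of_eq ?_) le_rfl)
  rw [← (pG n).measure_preimage
    (((mF n hB).symmDiff (mf hB)).nullMeasurableSet)]
  rfl

theorem WeaklyTendsto.congr_fun {F G : ℕ → Torus → Torus} {f : Torus → Torus}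
    (hF : WeaklyTendsto F f) (h : ∀ n, F n = G n) : WeaklyTendsto G f := by
  have : F = G := funext h
  exact this ▸ hF

theorem weaklyTendsto_const (f : Torus → Torus) : WeaklyTendsto (fun _ => f) f := by
  intro B _
  simp

/-- Pulling the error on $B$ back by $F_n$ turns it into the error of $F_n$ on the set $f(B)$. -/
theorem WeaklyTendsto.symm {F : ℕ → Equiv.Perm Torus} {f : Equiv.Perm Torus}
    (hF : WeaklyTendsto (fun n => F n) f) (pF : ∀ n, PreservesVolume (F n))
    (mF : ∀ n, Measurable (F n).symm) (mf : Measurable f.symm) :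
    WeaklyTendsto (fun n => (F n).symm) f.symm := by
  intro B hB
  refine (hF _ (mf hB)).congr fun n => ?_
  rw [← (pF n).measure_preimage (((mF n) hB).symmDiff (mf hB)).nullMeasurableSet, symmDiff_comm]
  congr 1
  ext x
  simp [Set.mem_symmDiff]

/-- Cover the torus by finitely many balls of radius ε/2. Where the two maps are ε apart, some ball
contains $f(x)$ but not $F_n(x)$, so $x$ lies in one of finitely many small symmetric differences.
-/
theorem WeaklyTendsto.tendstoInMeasure {F : ℕ → Torus → Torus} {f : Torus → Torus}
    (hF : WeaklyTendsto F f) : TendstoInMeasure volume F atTop f := by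
  rw [tendstoInMeasure_iff_dist]
  intro ε hε
  obtain ⟨t, ht⟩ := (isCompact_univ (X := Torus)).elim_finite_subcover
    (fun x : Torus => Metric.ball x (ε / 2)) (fun x => Metric.isOpen_ball)
    (fun x _ => Set.mem_iUnion.2 ⟨x, Metric.mem_ball_self (by positivity)⟩)
  have h : Tendsto (fun n => ∑ x ∈ t, volume ((F n ⁻¹' Metric.ball x (ε / 2)) ∆
      (f ⁻¹' Metric.ball x (ε / 2)))) atTop (𝓝 0) := by
    have := tendsto_finsetSum t fun x _ => hF (Metric.ball x (ε / 2)) measurableSet_ball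
    simpa using this
  refine tendsto_of_tendsto_of_tendsto_of_le_of_le tendsto_const_nhds h (fun _ => zero_le) ?_
  intro n
  refine (measure_mono ?_).trans (measure_biUnion_finset_le t _)
  intro x hx
  obtain ⟨y, hy, hxy⟩ := Set.mem_iUnion₂.1 (ht (Set.mem_univ (f x)))
  refine Set.mem_iUnion₂.2 ⟨y, hy, Or.inr ⟨hxy, fun hF' => ?_⟩⟩
  have h1 := Metric.mem_ball.1 hxy
  have h2 : dist (F n x) y < ε / 2 := Metric.mem_ball.1 hF'
  have := dist_triangle_right (F n x) (f x) y
  simp only [Set.mem_ofPred_eq] at hx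
  linarith

/-- Squeeze $B$ between a compact $K$ and an open $U$ of nearly the same measure. If $F_n(x)$ and
$f(x)$ are closer than the gap between $K$ and the complement of $U$, they can disagree about $B$
only when one of them lies in $U \setminus K$, which is rare as both maps preserve the measure. -/
theorem weaklyTendsto_of_tendstoInMeasure {F : ℕ → Torus → Torus} {f : Torus → Torus}
    (pF : ∀ n, PreservesVolume (F n)) (pf : PreservesVolume f)
    (h : TendstoInMeasure volume F atTop f) : WeaklyTendsto F f := by
  intro B hB
  rw [tendstoInMeasure_iff_dist] at h
  rw [ENNReal.tendsto_nhds_zero]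
  intro ε hε
  obtain ⟨δ, hδ, hδε⟩ : ∃ δ : ℝ≥0∞, 0 < δ ∧ δ + δ + δ + δ + δ ≤ ε := by
    refine ⟨ε / 5, ENNReal.div_pos hε.ne' (by simp), le_of_eq ?_⟩
    have : ε / 5 + ε / 5 + ε / 5 + ε / 5 + ε / 5 = 5 * (ε / 5) := by ring
    rw [this, ENNReal.mul_div_cancel (by simp) (by simp)]
  obtain ⟨K, hKB, hK, hKδ⟩ := hB.exists_isCompact_sdiff_lt (measure_ne_top volume B) hδ.ne'
  obtain ⟨U, hBU, hU, -, hUδ⟩ := hB.exists_isOpen_sdiff_lt (measure_ne_top volume B) hδ.ne'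
  obtain ⟨r, hr, hrU⟩ := hK.exists_thickening_subset_open hU (hKB.trans hBU)
  filter_upwards [ENNReal.tendsto_nhds_zero.1 (h r hr) δ hδ] with n hn
  have hsub : (F n ⁻¹' B) ∆ (f ⁻¹' B) ⊆ ((F n ⁻¹' (B \ K) ∪ f ⁻¹' (B \ K)) ∪
      (F n ⁻¹' (U \ B) ∪ f ⁻¹' (U \ B))) ∪ {x | r ≤ dist (F n x) (f x)} := by
    intro x hx
    by_contra hcon
    simp only [Set.mem_union, Set.mem_preimage, Set.mem_sdiff, Set.mem_ofPred_eq, not_or, not_and,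
      not_not, not_le] at hcon
    obtain ⟨⟨⟨h1, h2⟩, h3, h4⟩, h5⟩ := hcon
    rcases hx with ⟨hx1, hx2⟩ | ⟨hx1, hx2⟩
    · exact hx2 (h4 (hrU (Metric.mem_thickening_iff.2 ⟨_, h1 hx1, by rwa [dist_comm]⟩)))
    · exact hx2 (h3 (hrU (Metric.mem_thickening_iff.2 ⟨_, h2 hx1, h5⟩)))
  have m1 : MeasurableSet (B \ K) := hB.diff hK.measurableSet
  have m2 : MeasurableSet (U \ B) := hU.measurableSet.diff hB
  refine (measure_mono hsub).trans (le_trans ?_ hδε)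
  refine (measure_union_le _ _).trans ?_
  have e1 := (pF n).measure_preimage m1.nullMeasurableSet
  have e2 := pf.measure_preimage m1.nullMeasurableSet
  have e3 := (pF n).measure_preimage m2.nullMeasurableSet
  have e4 := pf.measure_preimage m2.nullMeasurableSet
  calc _ ≤ ((δ + δ) + (δ + δ)) + δ := by
        refine add_le_add ((measure_union_le _ _).trans (add_le_add ?_ ?_)) hn
        · exact (measure_union_le _ _).trans (add_le_add (e1 ▸ hKδ.le) (e2 ▸ hKδ.le))
        · exact (measure_union_le _ _).trans (add_le_add (e3 ▸ hUδ.le) (e4 ▸ hUδ.le))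
    _ = _ := by ring

theorem preservesVolume_of_tendsto_ae {F : ℕ → Torus → Torus} {f : Torus → Torus}
    (pF : ∀ n, PreservesVolume (F n)) (mf : Measurable f)
    (h : ∀ᵐ x, Tendsto (fun n => F n x) atTop (𝓝 (f x))) : PreservesVolume f := by
  refine ⟨mf, ?_⟩
  have : IsFiniteMeasure (Measure.map f (volume : Measure Torus)) := inferInstance
  refine ext_of_forall_integral_eq_of_IsFiniteMeasure fun φ => ?_
  rw [integral_map mf.aemeasurable φ.continuous.measurable.aestronglyMeasurable]
  have hlim : Tendsto (fun n => ∫ x, φ (F n x)) atTop (𝓝 (∫ x, φ (f x))) := by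
    refine tendsto_integral_of_dominated_convergence (fun _ => ‖φ‖)
      (fun n => (φ.continuous.measurable.comp (pF n).measurable).aestronglyMeasurable)
      (integrable_const _) (fun n => .of_forall fun x => φ.norm_coe_le_norm _) ?_
    filter_upwards [h] with x hx
    exact (φ.continuous.tendsto _).comp hx
  refine tendsto_nhds_unique hlim ?_
  refine tendsto_const_nhds.congr fun n => ?_
  conv_lhs => rw [← (pF n).map_eq]
  rw [integral_map (pF n).aemeasurable φ.continuous.measurable.aestronglyMeasurable]

theorem weaklyTendsto_of_tendsto_ae {F : ℕ → Torus → Torus} {f : Torus → Torus}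
    (pF : ∀ n, PreservesVolume (F n)) (pf : PreservesVolume f)
    (h : ∀ᵐ x, Tendsto (fun n => F n x) atTop (𝓝 (f x))) : WeaklyTendsto F f :=
  weaklyTendsto_of_tendstoInMeasure pF pf
    (tendstoInMeasure_of_tendsto_ae (fun n => (pF n).measurable.aestronglyMeasurable) h)

theorem WeaklyTendsto.ae_unique {F : ℕ → Torus → Torus} {f g : Torus → Torus}
    (hf : WeaklyTendsto F f) (hg : WeaklyTendsto F g) : f =ᵐ[volume] g :=
  tendstoInMeasure_ae_unique hf.tendstoInMeasure hg.tendstoInMeasure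

end

noncomputable section

/-! ### Diffeomorphisms with entire lifts -/

theorem bandNorm_le_iff {ρ : ℝ} {f : ℂ × ℂ → ℂ} {C : ℝ≥0∞} :
    bandNorm ρ f ≤ C ↔ ∀ z ∈ band ρ, ‖f z‖ₑ ≤ C := iSup₂_le_iff

theorem bandNorm_lt_top_iff {ρ : ℝ} {f : ℂ × ℂ → ℂ} :
    bandNorm ρ f < ⊤ ↔ ∃ C : ℝ, 0 ≤ C ∧ ∀ z ∈ band ρ, ‖f z‖ ≤ C := by
  constructor
  · intro h
    refine ⟨(bandNorm ρ f).toReal, ENNReal.toReal_nonneg, fun z hz => ?_⟩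
    have := bandNorm_le_iff.1 (le_refl (bandNorm ρ f)) z hz
    rw [← toReal_enorm]
    exact ENNReal.toReal_mono h.ne this
  · rintro ⟨C, h0, hC⟩
    refine lt_of_le_of_lt (bandNorm_le_iff.2 fun z hz => ?_) (ENNReal.ofReal_lt_top (r := C))
    rw [← ofReal_norm]
    exact ENNReal.ofReal_le_ofReal (hC z hz)

theorem isOpen_band (ρ : ℝ) : IsOpen (band ρ) := by
  have h1 : Continuous fun z : ℂ × ℂ => |z.1.im| := by fun_prop
  have h2 : Continuous fun z : ℂ × ℂ => |z.2.im| := by fun_prop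
  exact (isOpen_lt h1 continuous_const).inter (isOpen_lt h2 continuous_const)

theorem IsCOmega.add {ρ : ℝ} {f g : ℂ × ℂ → ℂ} (hf : IsCOmega ρ f) (hg : IsCOmega ρ g) :
    IsCOmega ρ (fun z => f z + g z) where
  holomorphic := hf.holomorphic.add hg.holomorphic
  bounded := by
    obtain ⟨C, hC, h⟩ := bandNorm_lt_top_iff.1 hf.bounded
    obtain ⟨D, hD, h'⟩ := bandNorm_lt_top_iff.1 hg.bounded
    exact bandNorm_lt_top_iff.2 ⟨C + D, by positivity,
      fun z hz => (norm_add_le _ _).trans (add_le_add (h z hz) (h' z hz))⟩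
  real x y := by simp [hf.real, hg.real]
  periodic x y m n := by rw [hf.periodic, hg.periodic]

theorem IsCOmega.sub {ρ : ℝ} {f g : ℂ × ℂ → ℂ} (hf : IsCOmega ρ f) (hg : IsCOmega ρ g) :
    IsCOmega ρ (fun z => f z - g z) where
  holomorphic := hf.holomorphic.sub hg.holomorphic
  bounded := by
    obtain ⟨C, hC, h⟩ := bandNorm_lt_top_iff.1 hf.bounded
    obtain ⟨D, hD, h'⟩ := bandNorm_lt_top_iff.1 hg.bounded
    exact bandNorm_lt_top_iff.2 ⟨C + D, by positivity,
      fun z hz => (norm_sub_le _ _).trans (add_le_add (h z hz) (h' z hz))⟩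
  real x y := by simp [hf.real, hg.real]
  periodic x y m n := by rw [hf.periodic, hg.periodic]

theorem isCOmega_const (ρ t : ℝ) : IsCOmega ρ (fun _ => (t : ℂ)) where
  holomorphic := differentiableOn_const _
  bounded := bandNorm_lt_top_iff.2 ⟨|t|, abs_nonneg t, fun z _ => by simp⟩
  real := by simp
  periodic := by simp

theorem IsCOmega.ofReal_re {ρ : ℝ} {f : ℂ × ℂ → ℂ} (hf : IsCOmega ρ f) (x y : ℝ) :
    ((f ((x : ℂ), (y : ℂ))).re : ℂ) = f ((x : ℂ), (y : ℂ)) :=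
  Complex.ext (by simp) (by simp [hf.real])

/-- The map `z + (f₁ z, f₂ z)` of `ℂ²`. -/
def displace (f₁ f₂ : ℂ × ℂ → ℂ) (z : ℂ × ℂ) : ℂ × ℂ := (z.1 + f₁ z, z.2 + f₂ z)

theorem displace_mapsTo_band {ρ C : ℝ} {f₁ f₂ : ℂ × ℂ → ℂ} (h₁ : ∀ z ∈ band ρ, ‖f₁ z‖ ≤ C)
    (h₂ : ∀ z ∈ band ρ, ‖f₂ z‖ ≤ C) : Set.MapsTo (displace f₁ f₂) (band ρ) (band (ρ + C)) := by
  intro z hz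
  constructor
  · calc |(z.1 + f₁ z).im| ≤ |z.1.im| + |(f₁ z).im| := by
          rw [Complex.add_im]; exact abs_add_le _ _
      _ < ρ + C := add_lt_add_of_lt_of_le hz.1 ((Complex.abs_im_le_norm _).trans (h₁ z hz))
  · calc |(z.2 + f₂ z).im| ≤ |z.2.im| + |(f₂ z).im| := by
          rw [Complex.add_im]; exact abs_add_le _ _
      _ < ρ + C := add_lt_add_of_lt_of_le hz.2 ((Complex.abs_im_le_norm _).trans (h₂ z hz))

theorem IsAnalyticLift.exists_bound {ρ : ℝ} {f : Torus → Torus} {f₁ f₂ : ℂ × ℂ → ℂ}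
    (h : IsAnalyticLift ρ f f₁ f₂) :
    ∃ C : ℝ, 0 ≤ C ∧ (∀ z ∈ band ρ, ‖f₁ z‖ ≤ C) ∧ ∀ z ∈ band ρ, ‖f₂ z‖ ≤ C := by
  obtain ⟨C, hC, h1⟩ := bandNorm_lt_top_iff.1 h.fst_mem.bounded
  obtain ⟨D, hD, h2⟩ := bandNorm_lt_top_iff.1 h.snd_mem.bounded
  exact ⟨max C D, le_max_of_le_left hC, fun z hz => (h1 z hz).trans (le_max_left _ _),
    fun z hz => (h2 z hz).trans (le_max_right _ _)⟩

/-- The inner displacement pushes the band of width ρ into a wider one; hence the outer function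
must be controlled on every band, and entire lifts are the class that is closed under composition.
-/
theorem IsCOmega.comp_displace {ρ : ℝ} {f : Torus → Torus} {f₁ f₂ g : ℂ × ℂ → ℂ}
    (hf : IsAnalyticLift ρ f f₁ f₂) (hg : ∀ ρ, IsCOmega ρ g) :
    IsCOmega ρ (fun z => g (displace f₁ f₂ z)) := by
  obtain ⟨C, -, h1, h2⟩ := hf.exists_bound
  have hm := displace_mapsTo_band h1 h2
  refine ⟨?_, ?_, ?_, ?_⟩
  · refine (hg (ρ + C)).holomorphic.comp ?_ hm
    exact (differentiableOn_fst.add hf.fst_mem.holomorphic).prodMk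
      (differentiableOn_snd.add hf.snd_mem.holomorphic)
  · obtain ⟨D, hD, h⟩ := bandNorm_lt_top_iff.1 (hg (ρ + C)).bounded
    exact bandNorm_lt_top_iff.2 ⟨D, hD, fun z hz => h _ (hm hz)⟩
  · intro x y
    have := (hg 0).real (x + (f₁ (x, y)).re) (y + (f₂ (x, y)).re)
    push_cast at this
    rwa [hf.fst_mem.ofReal_re, hf.snd_mem.ofReal_re] at this
  · intro x y m n
    have := (hg 0).periodic (x + (f₁ (x, y)).re) (y + (f₂ (x, y)).re) m n
    simp only [displace, hf.fst_mem.periodic, hf.snd_mem.periodic]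
    push_cast at this ⊢
    rw [hf.fst_mem.ofReal_re, hf.snd_mem.ofReal_re] at this
    rw [← this]
    congr 2 <;> ring

theorem IsAnalyticLift.comp {ρ : ℝ} {f g : Torus → Torus} {f₁ f₂ g₁ g₂ : ℂ × ℂ → ℂ}
    (hg : ∀ ρ, IsAnalyticLift ρ g g₁ g₂) (hf : IsAnalyticLift ρ f f₁ f₂) :
    IsAnalyticLift ρ (g ∘ f) (fun z => f₁ z + g₁ (displace f₁ f₂ z))
      (fun z => f₂ z + g₂ (displace f₁ f₂ z)) where
  fst_mem := hf.fst_mem.add (IsCOmega.comp_displace hf fun ρ => (hg ρ).fst_mem)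
  snd_mem := hf.snd_mem.add (IsCOmega.comp_displace hf fun ρ => (hg ρ).snd_mem)
  lift x y := by
    have := (hg 0).lift (x + (f₁ (x, y)).re) (y + (f₂ (x, y)).re)
    push_cast at this
    rw [hf.fst_mem.ofReal_re, hf.snd_mem.ofReal_re] at this
    rw [Function.comp_apply, hf.lift]
    rw [this]
    simp [displace, add_assoc]

theorem isAnalyticLift_rot (ρ t : ℝ) :
    IsAnalyticLift ρ (rot t) (fun _ => (t : ℂ)) (fun _ => 0) where
  fst_mem := isCOmega_const ρ t
  snd_mem := by simpa using isCOmega_const ρ 0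
  lift x y := by simp [rot]

/-- The map has a lift to `ℝ²` that extends to an entire map of `ℂ²`, differing from the identity
by a bounded function on every band. -/
def HasEntireLift (f : Torus → Torus) : Prop :=
  ∃ f₁ f₂ : ℂ × ℂ → ℂ, ∀ ρ, IsAnalyticLift ρ f f₁ f₂

theorem HasEntireLift.comp {f g : Torus → Torus} (hg : HasEntireLift g) (hf : HasEntireLift f) :
    HasEntireLift (g ∘ f) := by
  obtain ⟨g₁, g₂, hg⟩ := hg
  obtain ⟨f₁, f₂, hf⟩ := hf
  exact ⟨_, _, fun ρ => IsAnalyticLift.comp hg (hf ρ)⟩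

theorem hasEntireLift_rot (t : ℝ) : HasEntireLift (rot t) :=
  ⟨_, _, fun ρ => isAnalyticLift_rot ρ t⟩

theorem rot_apply (t : ℝ) (x : Torus) : rot t x = (x.1 + (t : UnitAddCircle), x.2) := by
  simp [rot, Prod.ext_iff]

theorem rot_zero : rot 0 = 1 := by
  ext x <;> simp [rot]

theorem rot_add (s t : ℝ) : rot (s + t) = rot s * rot t := by
  ext x
  · change x.1 + ((s + t : ℝ) : UnitAddCircle) = x.1 + t + s
    rw [AddCircle.coe_add]
    abel
  · simp [rot]

theorem rot_neg (t : ℝ) : rot (-t) = (rot t)⁻¹ := by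
  rw [eq_inv_iff_mul_eq_one, ← rot_add, neg_add_cancel, rot_zero]

theorem preservesVolume_rot (t : ℝ) : PreservesVolume (rot t) :=
  measurePreserving_add_right volume ((t : UnitAddCircle), (0 : UnitAddCircle))

/-- The group of the volume preserving diffeomorphisms that, with their inverses, have entire
lifts. -/
def entireGroup : Subgroup (Torus ≃ₜ Torus) where
  carrier := {f | PreservesVolume f ∧ HasEntireLift f ∧ HasEntireLift f.symm}
  mul_mem' := fun ⟨ha, ha', ha''⟩ ⟨hb, hb', hb''⟩ => ⟨ha.comp hb, ha'.comp hb', hb''.comp ha''⟩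
  one_mem' := by
    have h : HasEntireLift (1 : Torus ≃ₜ Torus) := rot_zero ▸ hasEntireLift_rot 0
    exact ⟨MeasurePreserving.id _, h, h⟩
  inv_mem' := fun {f} ⟨ha, ha', ha''⟩ =>
    ⟨MeasurePreserving.symm f.toMeasurableEquiv ha, ha'', ha'⟩

theorem rot_mem_entireGroup (t : ℝ) : rot t ∈ entireGroup := by
  refine ⟨preservesVolume_rot t, hasEntireLift_rot t, ?_⟩
  have := hasEntireLift_rot (-t)
  rwa [rot_neg] at this

theorem mem_diffOmega_of_mem_entireGroup {f : Torus ≃ₜ Torus} (hf : f ∈ entireGroup) (ρ : ℝ) :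
    f ∈ DiffOmega ρ := by
  obtain ⟨h, ⟨f₁, f₂, h'⟩, ⟨g₁, g₂, h''⟩⟩ := hf
  exact ⟨h, ⟨f₁, f₂, h' ρ⟩, ⟨g₁, g₂, h'' ρ⟩⟩

theorem mem_diffOmegaInfty_of_mem_entireGroup {f : Torus ≃ₜ Torus} (hf : f ∈ entireGroup) :
    f ∈ DiffOmegaInfty :=
  Set.mem_iInter.2 fun _ => mem_diffOmega_of_mem_entireGroup hf _

/-- The elements of `entireGroup` that commute with `R^{1/q}`. -/
def entireCentralizer (q : ℕ) : Subgroup (Torus ≃ₜ Torus) :=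
  entireGroup ⊓ Subgroup.centralizer {rot (1 / q)}

theorem commute_rot_of_mem_entireCentralizer {q : ℕ} {f : Torus ≃ₜ Torus}
    (hf : f ∈ entireCentralizer q) (p : ℕ) : Commute f (rot (p / q)) := by
  have h : Commute f (rot (1 / q)) := (Subgroup.mem_centralizer_singleton_iff.1 hf.2)
  have e : rot ((p : ℝ) / q) = rot (1 / q) ^ p := by
    induction p with
    | zero => simp [rot_zero]
    | succ p ih => rw [pow_succ, ← ih, ← rot_add]; congr 1; push_cast; ring
  rw [e]
  exact h.pow_right p

end

noncomputable section

/-! ### Shears by trigonometric polynomials -/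

/-- `p` is the restriction to the circle of an entire function bounded on horizontal bands. -/
structure IsTrig (p : UnitAddCircle → ℝ) : Prop where
  continuous : Continuous p
  exists_entire : ∃ P : ℂ → ℂ, Differentiable ℂ P ∧
    (∀ ρ : ℝ, ∃ C : ℝ, 0 ≤ C ∧ ∀ z : ℂ, |z.im| < ρ → ‖P z‖ ≤ C) ∧
    ∀ x : ℝ, P x = (p (x : UnitAddCircle) : ℂ)

/-- The exponential of frequency $n$ is bounded by $e^{2\pi|n|\rho}$ on the band, and the required
properties pass to linear combinations. -/
theorem exists_entire_of_mem_span_fourier {g : C(UnitAddCircle, ℂ)}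
    (hg : g ∈ Submodule.span ℂ (Set.range (fourier (T := 1)))) :
    ∃ P : ℂ → ℂ, Differentiable ℂ P ∧
      (∀ ρ : ℝ, ∃ C : ℝ, 0 ≤ C ∧ ∀ z : ℂ, |z.im| < ρ → ‖P z‖ ≤ C) ∧
      ∀ x : ℝ, P x = g (x : UnitAddCircle) := by
  induction hg using Submodule.span_induction with
  | mem g hg =>
    obtain ⟨n, rfl⟩ := hg
    refine ⟨fun z => Complex.exp (2 * Real.pi * Complex.I * n * z), by fun_prop, fun ρ =>
      ⟨Real.exp (2 * Real.pi * |(n : ℝ)| * ρ), by positivity, fun z hz => ?_⟩, fun x => ?_⟩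
    · rw [Complex.norm_exp, Real.exp_le_exp]
      have : (2 * Real.pi * Complex.I * n * z).re = 2 * Real.pi * (-(n * z.im)) := by
        simp
        ring
      rw [this, mul_assoc (2 * Real.pi)]
      refine mul_le_mul_of_nonneg_left ?_ (by positivity)
      calc -(n * z.im) ≤ |n * z.im| := neg_le_abs _
        _ = |(n : ℝ)| * |z.im| := abs_mul _ _
        _ ≤ _ := mul_le_mul_of_nonneg_left hz.le (abs_nonneg _)
    · rw [fourier_coe_apply]
      simp
  | zero => exact ⟨fun _ => 0, by fun_prop, fun ρ => ⟨0, le_rfl, by simp⟩, by simp⟩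
  | add f g _ _ hf hg =>
    obtain ⟨P, h1, h2, h3⟩ := hf
    obtain ⟨Q, h1', h2', h3'⟩ := hg
    refine ⟨fun z => P z + Q z, h1.add h1', fun ρ => ?_, fun x => by simp [h3, h3']⟩
    obtain ⟨C, hC, h⟩ := h2 ρ
    obtain ⟨D, hD, h'⟩ := h2' ρ
    exact ⟨C + D, by positivity, fun z hz => (norm_add_le _ _).trans (add_le_add (h z hz) (h' z hz))⟩
  | smul a f _ hf =>
    obtain ⟨P, h1, h2, h3⟩ := hf
    refine ⟨fun z => a * P z, h1.const_mul a, fun ρ => ?_, fun x => by simp [h3]⟩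
    obtain ⟨C, hC, h⟩ := h2 ρ
    refine ⟨‖a‖ * C, by positivity, fun z hz => ?_⟩
    rw [norm_mul]
    exact mul_le_mul_of_nonneg_left (h z hz) (norm_nonneg _)

theorem isTrig_re_of_mem_span_fourier {g : C(UnitAddCircle, ℂ)}
    (hg : g ∈ Submodule.span ℂ (Set.range (fourier (T := 1)))) :
    IsTrig fun x => (g x).re := by
  refine ⟨by fun_prop, ?_⟩
  obtain ⟨P, h1, h2, h3⟩ := exists_entire_of_mem_span_fourier hg
  have hconj : Differentiable ℂ fun z => (starRingEnd ℂ) (P ((starRingEnd ℂ) z)) := fun z => by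
    have := (h1 ((starRingEnd ℂ) z)).star_star
    rwa [starRingEnd_apply, star_star] at this
  -- The real part of `P` is not holomorphic; averaging with the Schwarz reflection gives a
  -- holomorphic function that agrees with it on the real line.
  refine ⟨fun z => (P z + (starRingEnd ℂ) (P ((starRingEnd ℂ) z))) / 2,
    (h1.add hconj).div_const 2, fun ρ => ?_, fun x => ?_⟩
  · obtain ⟨C, hC, h⟩ := h2 ρ
    refine ⟨C, hC, fun z hz => ?_⟩
    have a1 := h z hz
    have a2 := h ((starRingEnd ℂ) z) (by simpa using hz)
    rw [norm_div, Complex.norm_ofNat, div_le_iff₀ (by norm_num)]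
    refine (norm_add_le _ _).trans ?_
    rw [RCLike.norm_conj]
    linarith
  · simp only [Complex.conj_ofReal, h3]
    exact (Complex.re_eq_add_conj _).symm

theorem IsTrig.neg {p : UnitAddCircle → ℝ} (hp : IsTrig p) : IsTrig fun x => -p x := by
  obtain ⟨hc, P, h1, h2, h3⟩ := hp
  exact ⟨hc.neg, fun z => -P z, h1.neg, fun ρ => by simpa using h2 ρ, fun x => by simp [h3]⟩

/-- Regularity and Urysohn's lemma give a continuous function equal to the step function off a set
of measure δ, and trigonometric polynomials are uniformly dense among continuous functions. -/
theorem exists_isTrig_measure_le {U : Set UnitAddCircle} (hU : MeasurableSet U) (a : ℝ) {δ : ℝ}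
    (hδ : 0 < δ) : ∃ p, IsTrig p ∧
      volume {x | δ ≤ |p x - U.indicator (fun _ => a) x|} ≤ ENNReal.ofReal δ := by
  have hδ2 : ENNReal.ofReal (δ / 2) ≠ 0 := by simpa using hδ
  obtain ⟨K, hKU, hK, hKδ⟩ := hU.exists_isCompact_sdiff_lt (measure_ne_top volume U) hδ2
  obtain ⟨V, hUV, hV, -, hVδ⟩ := hU.exists_isOpen_sdiff_lt (measure_ne_top volume U) hδ2
  obtain ⟨c, hc0, hc1, -⟩ := exists_continuous_zero_one_of_isClosed hV.isClosed_compl hK.isClosed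
    (Set.disjoint_compl_left_iff_subset.2 (hKU.trans hUV))
  let f : C(UnitAddCircle, ℂ) := ⟨fun x => ((a * c x : ℝ) : ℂ), by fun_prop⟩
  have hf : f ∈ (Submodule.span ℂ (Set.range (fourier (T := 1)))).topologicalClosure := by
    rw [span_fourier_closure_eq_top]
    trivial
  obtain ⟨g, hg, hfg⟩ := Metric.mem_closure_iff.1 hf δ hδ
  refine ⟨_, isTrig_re_of_mem_span_fourier hg, ?_⟩
  have hsub : {x | δ ≤ |(g x).re - U.indicator (fun _ => a) x|} ⊆ (U \ K) ∪ (V \ U) := by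
    intro x hx
    by_contra hcon
    have hval : U.indicator (fun _ => a) x = a * c x := by
      simp only [Set.mem_union, Set.mem_sdiff, not_or, not_and, not_not] at hcon
      by_cases hxU : x ∈ U
      · rw [Set.indicator_of_mem hxU, hc1 (hcon.1 hxU)]
        simp
      · rw [Set.indicator_of_notMem hxU, hc0 fun h => hxU (hcon.2 h)]
        simp
    have h1 : dist (f x) (g x) < δ := (ContinuousMap.dist_apply_le_dist x).trans_lt hfg
    have h2 : |(g x).re - a * c x| ≤ dist (f x) (g x) := by
      rw [dist_comm, Complex.dist_eq]
      have := Complex.abs_re_le_norm (g x - f x)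
      simpa [f] using this
    rw [Set.mem_ofPred_eq, hval] at hx
    linarith
  calc _ ≤ volume (U \ K) + volume (V \ U) := (measure_mono hsub).trans (measure_union_le _ _)
    _ ≤ ENNReal.ofReal (δ / 2) + ENNReal.ofReal (δ / 2) := add_le_add hKδ.le hVδ.le
    _ = ENNReal.ofReal δ := by
      rw [← ENNReal.ofReal_add (by positivity) (by positivity), add_halves]

section Shear

variable {X Y : Type*}

/-- The map `(x, y) ↦ (x + φ y, y)`. -/
def horizontalShear [AddCommGroup X] (φ : Y → X) : Equiv.Perm (X × Y) where
  toFun x := (x.1 + φ x.2, x.2)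
  invFun x := (x.1 - φ x.2, x.2)
  left_inv x := by simp
  right_inv x := by simp

/-- The map `(x, y) ↦ (x, y + φ x)`. -/
def verticalShear [AddCommGroup Y] (φ : X → Y) : Equiv.Perm (X × Y) where
  toFun x := (x.1, x.2 + φ x.1)
  invFun x := (x.1, x.2 - φ x.1)
  left_inv x := by simp
  right_inv x := by simp

theorem horizontalShear_apply [AddCommGroup X] (φ : Y → X) (x : X × Y) :
    horizontalShear φ x = (x.1 + φ x.2, x.2) := rfl

theorem verticalShear_apply [AddCommGroup Y] (φ : X → Y) (x : X × Y) :
    verticalShear φ x = (x.1, x.2 + φ x.1) := rfl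

theorem horizontalShear_symm [AddCommGroup X] (φ : Y → X) :
    (horizontalShear φ).symm = horizontalShear fun y => -φ y := by
  ext x <;> simp [horizontalShear, sub_eq_add_neg]

theorem verticalShear_symm [AddCommGroup Y] (φ : X → Y) :
    (verticalShear φ).symm = verticalShear fun y => -φ y := by
  ext x <;> simp [verticalShear, sub_eq_add_neg]

end Shear

theorem preservesVolume_verticalShear {φ : UnitAddCircle → UnitAddCircle} (hφ : Measurable φ) :
    PreservesVolume (verticalShear φ) := by
  refine MeasurePreserving.skew_product (μa := volume) (μc := volume)
    (MeasurePreserving.id (volume : Measure UnitAddCircle))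
    (g := fun x y => y + φ x) (μd := volume) (by fun_prop) (.of_forall fun x => ?_)
  exact (measurePreserving_add_right volume (φ x)).map_eq

theorem preservesVolume_swap : PreservesVolume Prod.swap :=
  Measure.measurePreserving_swap (μ := (volume : Measure UnitAddCircle)) (ν := volume)

theorem preservesVolume_horizontalShear {φ : UnitAddCircle → UnitAddCircle} (hφ : Measurable φ) :
    PreservesVolume (horizontalShear φ) :=
  (preservesVolume_swap.comp (preservesVolume_verticalShear hφ)).comp preservesVolume_swap

theorem weaklyTendsto_verticalShear {φ : ℕ → UnitAddCircle → UnitAddCircle}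
    {ψ : UnitAddCircle → UnitAddCircle} (hφ : ∀ n, Measurable (φ n)) (hψ : Measurable ψ)
    (h : TendstoInMeasure volume φ atTop ψ) :
    WeaklyTendsto (fun n => verticalShear (φ n)) (verticalShear ψ) := by
  refine weaklyTendsto_of_tendstoInMeasure (fun n => preservesVolume_verticalShear (hφ n))
    (preservesVolume_verticalShear hψ) fun ε hε => (h ε hε).congr fun n => ?_
  have hm : MeasurableSet {x | ε ≤ edist (φ n x) (ψ x)} :=
    measurableSet_le measurable_const ((hφ n).edist hψ)
  have := (measurePreserving_fst (μ := (volume : Measure UnitAddCircle))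
    (ν := (volume : Measure UnitAddCircle))).measure_preimage hm.nullMeasurableSet
  rw [← this]
  congr 1
  ext x
  simp [verticalShear_apply, Prod.edist_eq]

theorem weaklyTendsto_horizontalShear {φ : ℕ → UnitAddCircle → UnitAddCircle}
    {ψ : UnitAddCircle → UnitAddCircle} (hφ : ∀ n, Measurable (φ n)) (hψ : Measurable ψ)
    (h : TendstoInMeasure volume φ atTop ψ) :
    WeaklyTendsto (fun n => horizontalShear (φ n)) (horizontalShear ψ) := by
  refine weaklyTendsto_of_tendstoInMeasure (fun n => preservesVolume_horizontalShear (hφ n))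
    (preservesVolume_horizontalShear hψ) fun ε hε => (h ε hε).congr fun n => ?_
  have hm : MeasurableSet {x | ε ≤ edist (φ n x) (ψ x)} :=
    measurableSet_le measurable_const ((hφ n).edist hψ)
  have := (measurePreserving_snd (μ := (volume : Measure UnitAddCircle))
    (ν := (volume : Measure UnitAddCircle))).measure_preimage hm.nullMeasurableSet
  rw [← this]
  congr 1
  ext x
  simp [horizontalShear_apply, Prod.edist_eq]

/-- `horizontalShear` by a continuous function, as a homeomorphism. -/
def horizontalShearHomeo (φ : C(UnitAddCircle, UnitAddCircle)) : Torus ≃ₜ Torus where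
  toEquiv := horizontalShear φ
  continuous_toFun := by
    change Continuous fun x : Torus => (x.1 + φ x.2, x.2)
    fun_prop
  continuous_invFun := by
    change Continuous fun x : Torus => (x.1 - φ x.2, x.2)
    fun_prop

/-- `verticalShear` by a continuous function, as a homeomorphism. -/
def verticalShearHomeo (φ : C(UnitAddCircle, UnitAddCircle)) : Torus ≃ₜ Torus where
  toEquiv := verticalShear φ
  continuous_toFun := by
    change Continuous fun x : Torus => (x.1, x.2 + φ x.1)
    fun_prop
  continuous_invFun := by
    change Continuous fun x : Torus => (x.1, x.2 - φ x.1)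
    fun_prop

theorem IsTrig.continuous_coe {p : UnitAddCircle → ℝ} (hp : IsTrig p) (q : ℕ) :
    Continuous fun x => ((p (q • x) : ℝ) : UnitAddCircle) :=
  (AddCircle.continuous_mk' 1).comp (hp.continuous.comp (continuous_nsmul q))

theorem entire_apply_natCast_mul {p : UnitAddCircle → ℝ} {P : ℂ → ℂ}
    (h : ∀ x : ℝ, P x = (p (x : UnitAddCircle) : ℂ)) (q : ℕ) (x : ℝ) :
    P (q * x) = (p (q • (x : UnitAddCircle)) : ℂ) := by
  have := h (q * x)
  push_cast at this
  rw [this, ← nsmul_eq_mul, AddCircle.coe_nsmul]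

theorem isCOmega_of_isTrig {p : UnitAddCircle → ℝ} {P : ℂ → ℂ} (h1 : Differentiable ℂ P)
    (h2 : ∀ ρ : ℝ, ∃ C : ℝ, 0 ≤ C ∧ ∀ z : ℂ, |z.im| < ρ → ‖P z‖ ≤ C)
    (h3 : ∀ x : ℝ, P x = (p (x : UnitAddCircle) : ℂ)) (q : ℕ) (ρ : ℝ) :
    IsCOmega ρ (fun z => P (q * z.1)) ∧ IsCOmega ρ (fun z => P (q * z.2)) := by
  have hb : ∃ C : ℝ, 0 ≤ C ∧ ∀ z : ℂ, |z.im| < ρ → ‖P (q * z)‖ ≤ C := by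
    -- The factor `q + 1` in place of `q` keeps the strict inequality when `q = 0`.
    obtain ⟨C, hC, h⟩ := h2 ((q + 1) * ρ)
    refine ⟨C, hC, fun z hz => h _ ?_⟩
    have e : (q * z).im = q * z.im := by simp
    rw [e, abs_mul, Nat.abs_cast]
    have := abs_nonneg z.im
    have hq : (0 : ℝ) ≤ q := Nat.cast_nonneg q
    nlinarith
  have hr := entire_apply_natCast_mul h3 q
  obtain ⟨C, hC, hb⟩ := hb
  have hper (x : ℝ) (m : ℤ) : ((x + m : ℝ) : UnitAddCircle) = x := by
    have : ((m : ℝ) : UnitAddCircle) = 0 := AddCircle.coe_eq_zero_iff 1 |>.2 ⟨m, by simp⟩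
    rw [AddCircle.coe_add, this, add_zero]
  refine ⟨⟨by fun_prop, bandNorm_lt_top_iff.2 ⟨C, hC, fun z hz => hb _ hz.1⟩, fun x y => ?_,
    fun x y m n => ?_⟩, ⟨by fun_prop, bandNorm_lt_top_iff.2 ⟨C, hC, fun z hz => hb _ hz.2⟩,
    fun x y => ?_, fun x y m n => ?_⟩⟩
  · simp only [hr, Complex.ofReal_im]
  · simp only [hr, hper]
  · simp only [hr, Complex.ofReal_im]
  · simp only [hr, hper]

theorem hasEntireLift_horizontalShear {p : UnitAddCircle → ℝ} (hp : IsTrig p) :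
    HasEntireLift (horizontalShear fun y => (p y : UnitAddCircle)) := by
  obtain ⟨-, P, h1, h2, h3⟩ := hp
  refine ⟨fun z => P z.2, fun _ => 0, fun ρ => ⟨by
    simpa using (isCOmega_of_isTrig h1 h2 h3 1 ρ).2, by simpa using isCOmega_const ρ 0,
    fun x y => ?_⟩⟩
  simp [horizontalShear_apply, h3]

theorem hasEntireLift_verticalShear {p : UnitAddCircle → ℝ} (hp : IsTrig p) (q : ℕ) :
    HasEntireLift (verticalShear fun x => (p (q • x) : UnitAddCircle)) := by
  obtain ⟨-, P, h1, h2, h3⟩ := hp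
  refine ⟨fun _ => 0, fun z => P (q * z.1), fun ρ => ⟨by simpa using isCOmega_const ρ 0,
    (isCOmega_of_isTrig h1 h2 h3 q ρ).1, fun x y => ?_⟩⟩
  rw [verticalShear_apply]
  simp only [entire_apply_natCast_mul h3, Complex.ofReal_re, AddCircle.coe_add, Complex.zero_re,
    add_zero]

theorem horizontalShearHomeo_mem {p : UnitAddCircle → ℝ} (hp : IsTrig p) (q : ℕ) :
    horizontalShearHomeo ⟨fun y => (p y : UnitAddCircle), by simpa using hp.continuous_coe 1⟩ ∈
      entireCentralizer q := by
  refine ⟨⟨preservesVolume_horizontalShear ?_, hasEntireLift_horizontalShear hp, ?_⟩, ?_⟩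
  · exact (ContinuousMap.continuous _).measurable
  · have := hasEntireLift_horizontalShear hp.neg
    simp only [AddCircle.coe_neg] at this
    rwa [← horizontalShear_symm fun y => (p y : UnitAddCircle)] at this
  · refine Subgroup.mem_centralizer_singleton_iff.2 ?_
    ext x
    · change (rot (1 / q) x).1 + ((p (rot (1 / q) x).2 : ℝ) : UnitAddCircle) =
        x.1 + ((p x.2 : ℝ) : UnitAddCircle) + ((1 / q : ℝ) : UnitAddCircle)
      rw [rot_apply]
      simp only
      abel
    · rfl

theorem nsmul_rot {q : ℕ} (hq : q ≠ 0) (x : Torus) : q • (rot (1 / q) x).1 = q • x.1 := by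
  have : q • (((1 / q : ℝ)) : UnitAddCircle) = 0 := by
    rw [← AddCircle.coe_nsmul, nsmul_eq_mul, mul_one_div_cancel (by exact_mod_cast hq)]
    exact AddCircle.coe_period 1
  simp only [rot, Homeomorph.coe_addRight, Prod.fst_add, smul_add, this, add_zero]

/-- Commutation with $R^{1/q}$ is the reason for composing `p` with multiplication by `q`: the shear
then depends only on $q x_1$, which the rotation fixes. -/
theorem verticalShearHomeo_mem {p : UnitAddCircle → ℝ} (hp : IsTrig p) {q : ℕ} (hq : q ≠ 0) :
    verticalShearHomeo ⟨fun x => (p (q • x) : UnitAddCircle), hp.continuous_coe q⟩ ∈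
      entireCentralizer q := by
  refine ⟨⟨preservesVolume_verticalShear ?_, hasEntireLift_verticalShear hp q, ?_⟩, ?_⟩
  · exact (ContinuousMap.continuous _).measurable
  · have := hasEntireLift_verticalShear hp.neg q
    simp only [AddCircle.coe_neg] at this
    rwa [← verticalShear_symm fun x => (p (q • x) : UnitAddCircle)] at this
  · refine Subgroup.mem_centralizer_singleton_iff.2 ?_
    ext x
    · rfl
    · change (rot (1 / q) x).2 + ((p (q • (rot (1 / q) x).1) : ℝ) : UnitAddCircle) =
        x.2 + ((p (q • x.1) : ℝ) : UnitAddCircle) + 0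
      rw [nsmul_rot hq]
      simp [rot]

end

noncomputable section

/-! ### Rectangle exchanges as products of shears -/

section Exchange

variable {X Y : Type*}

/-- The shear that moves the rows in `U` by `a`. -/
def rowShear [AddCommGroup X] (U : Set Y) (a : X) : Equiv.Perm (X × Y) := horizontalShear (U.indicator fun _ => a)

/-- The shear that moves the columns in `W` by `b`. -/
def colShear [AddCommGroup Y] (W : Set X) (b : Y) : Equiv.Perm (X × Y) := verticalShear (W.indicator fun _ => b)

open Classical in
theorem rowShear_apply [AddCommGroup X] (U : Set Y) (a x : X) (y : Y) :
    rowShear U a (x, y) = if y ∈ U then (x + a, y) else (x, y) := by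
  by_cases h : y ∈ U <;> simp [rowShear, horizontalShear_apply, h]

open Classical in
theorem colShear_apply [AddCommGroup Y] (W : Set X) (b : Y) (x : X) (y : Y) :
    colShear W b (x, y) = if x ∈ W then (x, y + b) else (x, y) := by
  by_cases h : x ∈ W <;> simp [colShear, verticalShear_apply, h]

variable [AddCommGroup X] [AddCommGroup Y]

/-- The commutator of a row shear and a column shear. If `W` and `U` are disjoint from their
translates by `a` and `b`, it permutes `W × U`, `(W + a) × U` and `W × (U + b)` cyclically. -/
def cornerCycle (W : Set X) (U : Set Y) (a : X) (b : Y) : Equiv.Perm (X × Y) :=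
  rowShear U a * colShear W b * rowShear U (-a) * colShear W (-b)

section

variable {W : Set X} {U : Set Y} {a : X} {b : Y}

/-- The rightmost factor acts first: it moves the point out of the rows `U`, so the next shear
misses it and the third one brings it back before the final move by `a`. -/
theorem cornerCycle_apply_corner (hU : ∀ y ∈ U, y - b ∉ U) {x : X} {y : Y}
    (hx : x ∈ W) (hy : y ∈ U) : cornerCycle W U a b (x, y) = (x + a, y) := by
  have := hU y hy
  simp [cornerCycle, rowShear_apply, colShear_apply, ← sub_eq_add_neg, hx, hy, this]

theorem cornerCycle_apply_right (hW : ∀ x ∈ W, x - a ∉ W) (hU : ∀ y ∈ U, y - b ∉ U) {x : X} {y : Y}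
    (hx : x ∈ W) (hy : y ∈ U) : cornerCycle W U a b (x + a, y) = (x, y + b) := by
  have h1 : x + a ∉ W := fun h => hW _ h (by simpa using hx)
  have h2 : y + b ∉ U := fun h => hU _ h (by simpa using hy)
  simp [cornerCycle, rowShear_apply, colShear_apply, hx, hy, h1, h2]

theorem cornerCycle_apply_up (hW : ∀ x ∈ W, x - a ∉ W) {x : X} {y : Y}
    (hx : x ∈ W) (hy : y ∈ U) : cornerCycle W U a b (x, y + b) = (x, y) := by
  have h1 := hW x hx
  simp [cornerCycle, rowShear_apply, colShear_apply, ← sub_eq_add_neg, hx, hy, h1]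

theorem cornerCycle_apply_of_notMem {x : X} {y : Y} (h1 : ¬ (x ∈ W ∧ y ∈ U))
    (h2 : ¬ (x - a ∈ W ∧ y ∈ U)) (h3 : ¬ (x ∈ W ∧ y - b ∈ U)) :
    cornerCycle W U a b (x, y) = (x, y) := by
  simp only [not_and] at h1 h2 h3
  by_cases hx : x ∈ W
  · simp [cornerCycle, rowShear_apply, colShear_apply, ← sub_eq_add_neg, hx, h1 hx, h3 hx]
  · by_cases hy : y ∈ U
    · have : x - a ∉ W := fun h => h2 h hy
      simp [cornerCycle, rowShear_apply, colShear_apply, ← sub_eq_add_neg, hx, hy, this]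
    · simp [cornerCycle, rowShear_apply, colShear_apply, hx, hy]

/-- The exchange of `W × (U ∪ (U + b))` and `(W + a) × (U ∪ (U + b))`. -/
def rowExchange (W : Set X) (U : Set Y) (a : X) (b : Y) : Equiv.Perm (X × Y) :=
  (cornerCycle W U a b)⁻¹ * cornerCycle W {y | y - b ∈ U} a (-b)

/-- The exchange of `(W ∪ (W + a)) × U` and `(W ∪ (W + a)) × (U + b)`. -/
def colExchange (W : Set X) (U : Set Y) (a : X) (b : Y) : Equiv.Perm (X × Y) :=
  (cornerCycle W {y | y - b ∈ U} a (-b))⁻¹ * cornerCycle {x | x - a ∈ W} U (-a) b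

/-- Moving the inverse to the other side leaves only forward cycles to evaluate. -/
theorem rowExchange_eq {p r : X × Y}
    (h : cornerCycle W {y | y - b ∈ U} a (-b) p = cornerCycle W U a b r) :
    rowExchange W U a b p = r := by
  rw [rowExchange, Equiv.Perm.mul_apply, Equiv.Perm.inv_eq_iff_eq, h]

theorem colExchange_eq {p r : X × Y}
    (h : cornerCycle {x | x - a ∈ W} U (-a) b p = cornerCycle W {y | y - b ∈ U} a (-b) r) :
    colExchange W U a b p = r := by
  rw [colExchange, Equiv.Perm.mul_apply, Equiv.Perm.inv_eq_iff_eq, h]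

/-- The second cycle starts from the translated set with the opposite step; this supplies its
disjointness hypothesis. -/
theorem disjoint_translate_neg {Z : Type*} [AddCommGroup Z] {V : Set Z} {c : Z}
    (h : ∀ z ∈ V, z - c ∉ V) : ∀ z ∈ {z | z - c ∈ V}, z - -c ∉ {z | z - c ∈ V} := fun z hz hz' =>
  h z (by simpa using hz') hz

/-- The two 3-cycles share the rectangles $W \times U$ and $W \times (U+b)$, and their product is
the pair of transpositions that exchanges left and right in both rows. -/
theorem rowExchange_apply_left (hW : ∀ x ∈ W, x - a ∉ W) (hU : ∀ y ∈ U, y - b ∉ U) {x : X} {y : Y}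
    (hx : x ∈ W) (hy : y ∈ U ∨ y - b ∈ U) : rowExchange W U a b (x, y) = (x + a, y) := by
  have hU' := disjoint_translate_neg hU
  have hx' : x + a ∉ W := fun h => hW _ h (by simpa using hx)
  apply rowExchange_eq
  rcases hy with hy | hy
  · have := cornerCycle_apply_up (U := {y | y - b ∈ U}) (b := -b) hW hx
      (show y + b ∈ {y | y - b ∈ U} by simpa using hy)
    rw [cornerCycle_apply_right hW hU hx hy]
    simpa using this
  · rw [cornerCycle_apply_corner hU' hx hy, cornerCycle_apply_of_notMem (by simp [hx'])
      (fun h => hU y h.2 hy) (by simp [hx'])]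

theorem rowExchange_apply_right (hW : ∀ x ∈ W, x - a ∉ W) (hU : ∀ y ∈ U, y - b ∉ U) {x : X} {y : Y}
    (hx : x - a ∈ W) (hy : y ∈ U ∨ y - b ∈ U) : rowExchange W U a b (x, y) = (x - a, y) := by
  have hU' := disjoint_translate_neg hU
  have hx' : x ∉ W := fun h => hW _ h hx
  apply rowExchange_eq
  rcases hy with hy | hy
  · rw [cornerCycle_apply_corner hU hx hy, sub_add_cancel]
    exact cornerCycle_apply_of_notMem (by simp [hx']) (fun h => hU y hy h.2) (by simp [hx'])
  · have h1 := cornerCycle_apply_right hW hU' hx hy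
    have h2 := cornerCycle_apply_up (b := b) hW hx hy
    simp only [sub_add_cancel] at h1 h2
    rw [h1, h2, ← sub_eq_add_neg y b]

theorem rowExchange_apply_of_notMem {x : X} {y : Y}
    (h : ¬ (x ∈ W ∨ x - a ∈ W) ∨ ¬ (y ∈ U ∨ y - b ∈ U)) :
    rowExchange W U a b (x, y) = (x, y) := by
  apply rowExchange_eq
  have h1 : cornerCycle W {y | y - b ∈ U} a (-b) (x, y) = (x, y) := by
    apply cornerCycle_apply_of_notMem <;>
      simp only [Set.mem_ofPred_eq, sub_neg_eq_add, add_sub_cancel_right] <;> tauto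
  have h2 : cornerCycle W U a b (x, y) = (x, y) := by
    apply cornerCycle_apply_of_notMem <;> tauto
  rw [h1, h2]

/-- Here the two 3-cycles share the diagonal rectangles $W \times U$ and $(W+a) \times (U+b)$, and
the product exchanges bottom and top in both columns. -/
theorem colExchange_apply_bottom (hW : ∀ x ∈ W, x - a ∉ W) (hU : ∀ y ∈ U, y - b ∉ U) {x : X} {y : Y}
    (hy : y ∈ U) (hx : x ∈ W ∨ x - a ∈ W) : colExchange W U a b (x, y) = (x, y + b) := by
  have hU' := disjoint_translate_neg hU
  have hW' := disjoint_translate_neg hW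
  have hy' : y + b ∈ {y | y - b ∈ U} := by simpa using hy
  apply colExchange_eq
  rcases hx with hx | hx
  · have := cornerCycle_apply_right hW' hU
      (show x + a ∈ {x | x - a ∈ W} by simpa using hx) hy
    rw [cornerCycle_apply_corner hU' hx hy']
    simpa using this
  · have h1 : cornerCycle {x | x - a ∈ W} U (-a) b (x, y) = (x + -a, y) :=
      cornerCycle_apply_corner hU hx hy
    have h2 := cornerCycle_apply_right hW hU' hx hy'
    simp only [sub_add_cancel, add_neg_cancel_right] at h2
    rw [h1, h2, sub_eq_add_neg]

theorem colExchange_apply_top (hW : ∀ x ∈ W, x - a ∉ W) (hU : ∀ y ∈ U, y - b ∉ U) {x : X} {y : Y}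
    (hy : y - b ∈ U) (hx : x ∈ W ∨ x - a ∈ W) : colExchange W U a b (x, y) = (x, y - b) := by
  have hW' := disjoint_translate_neg hW
  have hy' : y ∉ U := fun h => hU y h hy
  have hy2 : y - b - b ∉ U := hU _ hy
  apply colExchange_eq
  rcases hx with hx | hx
  · have h1 : cornerCycle {x | x - a ∈ W} U (-a) b (x, y) = (x, y) :=
      cornerCycle_apply_of_notMem (by simp [hy']) (by simp [hy']) (fun h => hW _ hx h.1)
    have h2 : cornerCycle W {y | y - b ∈ U} a (-b) (x, y + -b) = (x, y) :=
      cornerCycle_apply_up hW hx hy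
    rw [h1, sub_eq_add_neg y b, h2]
  · have := cornerCycle_apply_up (b := b) hW' hx hy
    have hx' : x ∉ W := fun h => hW x h hx
    simp only [sub_add_cancel] at this
    have h2 : cornerCycle W {y | y - b ∈ U} a (-b) (x, y - b) = (x, y - b) :=
      cornerCycle_apply_of_notMem (by simp [hx']) (by simp [hy2]) (by simp [hx'])
    rw [this, h2]

theorem colExchange_apply_of_notMem {x : X} {y : Y}
    (h : ¬ (x ∈ W ∨ x - a ∈ W) ∨ ¬ (y ∈ U ∨ y - b ∈ U)) :
    colExchange W U a b (x, y) = (x, y) := by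
  apply colExchange_eq
  have h1 : cornerCycle W {y | y - b ∈ U} a (-b) (x, y) = (x, y) := by
    apply cornerCycle_apply_of_notMem <;>
      simp only [Set.mem_ofPred_eq, sub_neg_eq_add, add_sub_cancel_right] <;> tauto
  have h2 : cornerCycle {x | x - a ∈ W} U (-a) b (x, y) = (x, y) := by
    apply cornerCycle_apply_of_notMem <;>
      simp only [Set.mem_ofPred_eq, sub_neg_eq_add, add_sub_cancel_right] <;> tauto
  rw [h1, h2]

variable {G : Subgroup (Equiv.Perm (X × Y))} {P : Set X → Prop} {Q : Set Y → Prop}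

/-- The predicates `P` and `Q` let the sets of columns be restricted to periodic ones while the sets
of rows need only be measurable. -/
theorem rowExchange_mem (hrow : ∀ U a, Q U → rowShear U a ∈ G) (hcol : ∀ W b, P W → colShear W b ∈ G)
    (hW : P W) (hU : Q U) (hU' : Q {y | y - b ∈ U}) : rowExchange W U a b ∈ G := by
  have := fun U W a b (hU : Q U) (hW : P W) => G.mul_mem (G.mul_mem (G.mul_mem (hrow U a hU)
    (hcol W b hW)) (hrow U (-a) hU)) (hcol W (-b) hW)
  exact G.mul_mem (G.inv_mem (this _ _ _ _ hU hW)) (this _ _ _ _ hU' hW)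

theorem colExchange_mem (hrow : ∀ U a, Q U → rowShear U a ∈ G) (hcol : ∀ W b, P W → colShear W b ∈ G)
    (hW : P W) (hW' : P {x | x - a ∈ W}) (hU : Q U) (hU' : Q {y | y - b ∈ U}) :
    colExchange W U a b ∈ G := by
  have := fun U W a b (hU : Q U) (hW : P W) => G.mul_mem (G.mul_mem (G.mul_mem (hrow U a hU)
    (hcol W b hW)) (hrow U (-a) hU)) (hcol W (-b) hW)
  exact G.mul_mem (G.inv_mem (this _ _ _ _ hU' hW)) (this _ _ _ _ hU hW')

end

end Exchange

end

noncomputable section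

/-! ### Weak limits of entire diffeomorphisms -/

theorem PreservesVolume.perm_symm {h : Equiv.Perm Torus} (hh : PreservesVolume h)
    (mh : Measurable h.symm) : PreservesVolume h.symm :=
  MeasurePreserving.symm ⟨h, hh.measurable, mh⟩ hh

theorem PreservesVolume.homeo_symm {h : Torus ≃ₜ Torus} (hh : PreservesVolume h) :
    PreservesVolume h.symm :=
  hh.perm_symm (h := h.toEquiv) h.symm.continuous.measurable

theorem preservesVolume_of_mem_entireCentralizer {q : ℕ} {g : Torus ≃ₜ Torus}
    (hg : g ∈ entireCentralizer q) : PreservesVolume g := hg.1.1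

/-- The group of the volume preserving permutations of the torus that are weak limits of elements of
`entireCentralizer q`. -/
def approxGroup (q : ℕ) : Subgroup (Equiv.Perm Torus) where
  carrier := {h | PreservesVolume h ∧ Measurable h.symm ∧
    ∃ g : ℕ → Torus ≃ₜ Torus, (∀ n, g n ∈ entireCentralizer q) ∧ WeaklyTendsto (fun n => g n) h}
  mul_mem' := by
    rintro a b ⟨ha, ha', g, hg, hga⟩ ⟨hb, hb', f, hf, hfb⟩
    refine ⟨ha.comp hb, hb'.comp ha', fun n => g n * f n, fun n => mul_mem (hg n) (hf n), ?_⟩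
    exact hga.comp hfb (fun n => (g n).continuous.measurable) ha.measurable
      fun n => preservesVolume_of_mem_entireCentralizer (hf n)
  one_mem' := ⟨MeasurePreserving.id _, measurable_id, fun _ => 1, fun _ => one_mem _,
    weaklyTendsto_const _⟩
  inv_mem' := by
    rintro a ⟨ha, ha', g, hg, hga⟩
    refine ⟨ha.perm_symm ha', ha.measurable, fun n => (g n)⁻¹, fun n => inv_mem (hg n), ?_⟩
    exact WeaklyTendsto.symm (F := fun n => (g n).toEquiv) hga
      (fun n => preservesVolume_of_mem_entireCentralizer (hg n))
      (fun n => (g n).symm.continuous.measurable) ha'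

theorem exists_seq_isTrig_tendstoInMeasure {U : Set UnitAddCircle} (hU : MeasurableSet U)
    (a : UnitAddCircle) : ∃ p : ℕ → UnitAddCircle → ℝ, (∀ n, IsTrig (p n)) ∧
      TendstoInMeasure volume (fun n x => (p n x : UnitAddCircle)) atTop
        (U.indicator fun _ => a) := by
  -- With a real representative of `a`, the approximation takes place among real functions and is
  -- then projected to the circle, which does not increase distances.
  obtain ⟨a, rfl⟩ := QuotientAddGroup.mk_surjective a
  choose p hp hpU using fun n : ℕ => exists_isTrig_measure_le hU a
    (δ := 1 / ((n : ℝ) + 1)) Nat.one_div_pos_of_nat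
  refine ⟨p, hp, ?_⟩
  rw [tendstoInMeasure_iff_dist]
  intro ε hε
  have h0 := tendsto_one_div_add_atTop_nhds_zero_nat (𝕜 := ℝ)
  have h : Tendsto (fun n : ℕ => ENNReal.ofReal (1 / ((n : ℝ) + 1))) atTop (𝓝 0) := by
    simpa using ENNReal.tendsto_ofReal h0
  refine tendsto_of_tendsto_of_tendsto_of_le_of_le' tendsto_const_nhds h
    (.of_forall fun _ => zero_le) ?_
  filter_upwards [h0.eventually (gt_mem_nhds hε)] with n hn
  refine (measure_mono fun x hx => ?_).trans (hpU n)
  refine hn.le.trans (le_trans hx ?_)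
  have e : U.indicator (fun _ => (a : UnitAddCircle)) x =
      ((U.indicator (fun _ => a) x : ℝ) : UnitAddCircle) := by
    by_cases h : x ∈ U <;> simp [h]
  change dist (p n x : UnitAddCircle) (U.indicator (fun _ => (a : UnitAddCircle)) x) ≤ _
  rw [e, dist_eq_norm, ← AddCircle.coe_sub]
  exact (QuotientAddGroup.norm_mk_le_norm).trans (Real.norm_eq_abs _).le

theorem rowShear_mem_approxGroup (q : ℕ) {U : Set UnitAddCircle} (hU : MeasurableSet U)
    (a : UnitAddCircle) : (rowShear U a : Equiv.Perm Torus) ∈ approxGroup q := by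
  have hm (c : UnitAddCircle) : Measurable (U.indicator fun _ => c) :=
    measurable_const.indicator hU
  obtain ⟨p, hp, hpU⟩ := exists_seq_isTrig_tendstoInMeasure hU a
  refine ⟨preservesVolume_horizontalShear (hm a), ?_, _, fun n => horizontalShearHomeo_mem (hp n) q,
    weaklyTendsto_horizontalShear (fun n => ?_) (hm a) hpU⟩
  · rw [rowShear, horizontalShear_symm]
    exact (preservesVolume_horizontalShear (hm a).neg).measurable
  · exact (by simpa using (hp n).continuous_coe 1 : Continuous _).measurable

/-- Multiplication by `q` preserves the measure of the circle, so convergence in measure of the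
trigonometric polynomials survives composition with it. -/
theorem colShear_mem_approxGroup {q : ℕ} (hq : q ≠ 0) {W : Set UnitAddCircle} (hW : MeasurableSet W)
    (b : UnitAddCircle) :
    (colShear {x | q • x ∈ W} b : Equiv.Perm Torus) ∈ approxGroup q := by
  have hq' : MeasurePreserving (fun x : UnitAddCircle => q • x) volume volume := by
    simpa using Measure.measurePreserving_zsmul (volume : Measure UnitAddCircle) (n := (q : ℤ))
      (by exact_mod_cast hq)
  have hm (c : UnitAddCircle) : Measurable ({x : UnitAddCircle | q • x ∈ W}.indicator fun _ => c) :=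
    measurable_const.indicator (hq'.measurable hW)
  obtain ⟨p, hp, hpW⟩ := exists_seq_isTrig_tendstoInMeasure hW b
  have hc (n : ℕ) : Measurable fun x : UnitAddCircle => (p n x : UnitAddCircle) :=
    (by simpa using (hp n).continuous_coe 1 : Continuous _).measurable
  refine ⟨preservesVolume_verticalShear (hm b), ?_, _, fun n => verticalShearHomeo_mem (hp n) hq,
    weaklyTendsto_verticalShear (fun n => ((hp n).continuous_coe q).measurable) (hm b)
    fun ε hε => (hpW ε hε).congr fun n => ?_⟩
  · rw [colShear, verticalShear_symm]
    exact (preservesVolume_verticalShear (hm b).neg).measurable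
  · have hs : MeasurableSet {x | ε ≤ edist (p n x : UnitAddCircle) (W.indicator (fun _ => b) x)} :=
      measurableSet_le measurable_const ((hc n).edist (measurable_const.indicator hW))
    rw [← hq'.measure_preimage hs.nullMeasurableSet]
    rfl

/-! ### Arcs of the circle -/

/-- The arc `[i/n, (i+1)/n)`. -/
def arc (n i : ℕ) : Set UnitAddCircle :=
  {x | ∃ u ∈ Set.Ico ((i : ℝ) / n) (((i : ℝ) + 1) / n), x = (u : UnitAddCircle)}

/-- For `i < n` the interval lies in $[0,1)$, so its only possible representative of `x` is the
canonical one. -/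
theorem mem_arc_iff {n i : ℕ} (hi : i < n) (x : UnitAddCircle) :
    x ∈ arc n i ↔ (AddCircle.measurableEquivIco 1 0 x : ℝ) ∈
      Set.Ico ((i : ℝ) / n) (((i : ℝ) + 1) / n) := by
  have hn : (0 : ℝ) < n := by exact_mod_cast (Nat.zero_le i).trans_lt hi
  have hx : ((AddCircle.measurableEquivIco 1 0 x : ℝ) : UnitAddCircle) = x :=
    (AddCircle.equivIco (1 : ℝ) 0).symm_apply_apply x
  refine ⟨?_, fun h => ⟨_, h, hx.symm⟩⟩
  rintro ⟨u, hu, rfl⟩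
  have hi' : ((i : ℝ) + 1) / n ≤ 1 := by
    rw [div_le_one hn]
    exact_mod_cast hi
  have hu' : u ∈ Set.Ico (0 : ℝ) (0 + 1) :=
    ⟨le_trans (by positivity) hu.1, by linarith [hu.2]⟩
  have := (AddCircle.coe_eq_coe_iff_of_mem_Ico (p := (1 : ℝ))
    (AddCircle.measurableEquivIco 1 0 (u : UnitAddCircle)).2 hu').1 hx
  rwa [this]

theorem measurableSet_arc {n i : ℕ} (hi : i < n) : MeasurableSet (arc n i) := by
  have : arc n i = (fun x => (AddCircle.measurableEquivIco 1 0 x : ℝ)) ⁻¹'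
      Set.Ico ((i : ℝ) / n) (((i : ℝ) + 1) / n) := Set.ext (mem_arc_iff hi)
  rw [this]
  exact (measurable_subtype_coe.comp (AddCircle.measurableEquivIco 1 0).measurable)
    measurableSet_Ico

theorem eq_floor_of_mem_Ico {n i : ℕ} (hn : 0 < n) {u : ℝ}
    (h : u ∈ Set.Ico ((i : ℝ) / n) (((i : ℝ) + 1) / n)) : ⌊n * u⌋₊ = i := by
  have hn : (0 : ℝ) < n := by exact_mod_cast hn
  obtain ⟨h1, h2⟩ := h
  rw [div_le_iff₀ hn] at h1
  rw [lt_div_iff₀ hn] at h2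
  rw [Nat.floor_eq_iff (le_trans (by positivity) (h1.trans (mul_comm _ _).le))]
  constructor <;> linarith

theorem eq_of_mem_arc {n i j : ℕ} (hi : i < n) (hj : j < n) {x : UnitAddCircle} (h : x ∈ arc n i)
    (h' : x ∈ arc n j) : i = j :=
  have hn := (Nat.zero_le i).trans_lt hi
  (eq_floor_of_mem_Ico hn ((mem_arc_iff hi x).1 h)).symm.trans
    (eq_floor_of_mem_Ico hn ((mem_arc_iff hj x).1 h'))

theorem exists_mem_arc {n : ℕ} (hn : 0 < n) (x : UnitAddCircle) : ∃ i : Fin n, x ∈ arc n i := by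
  have hn' : (0 : ℝ) < n := by exact_mod_cast hn
  set u : ℝ := (AddCircle.measurableEquivIco 1 0 x : ℝ) with hu
  have h0 : 0 ≤ u := (AddCircle.measurableEquivIco 1 0 x).2.1
  have h1 : u < 1 := (AddCircle.measurableEquivIco 1 0 x).2.2.trans_eq (zero_add 1)
  have h0' : 0 ≤ n * u := by positivity
  have hi : ⌊n * u⌋₊ < n := by
    rw [Nat.floor_lt h0']
    nlinarith
  refine ⟨⟨_, hi⟩, (mem_arc_iff hi x).2 ?_⟩
  rw [Set.mem_Ico, div_le_iff₀ hn', lt_div_iff₀ hn', ← hu]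
  have := Nat.floor_le h0'
  have := Nat.lt_floor_add_one (n * u)
  constructor <;> linarith

theorem add_mem_arc {n i : ℕ} (j : ℕ) {x : UnitAddCircle} (h : x ∈ arc n i) :
    x + (((j : ℝ) / n - (i : ℝ) / n : ℝ) : UnitAddCircle) ∈ arc n j := by
  obtain ⟨u, ⟨h1, h2⟩, rfl⟩ := h
  refine ⟨u + ((j : ℝ) / n - (i : ℝ) / n), ⟨by linarith, ?_⟩, by rw [AddCircle.coe_add]⟩
  rw [add_div] at h2 ⊢
  linarith

theorem sub_mem_arc_iff {n i : ℕ} (j : ℕ) {x : UnitAddCircle} :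
    x - (((j : ℝ) / n - (i : ℝ) / n : ℝ) : UnitAddCircle) ∈ arc n i ↔ x ∈ arc n j := by
  constructor
  · intro h
    simpa using add_mem_arc j h
  · intro h
    have := add_mem_arc i h
    rwa [← neg_sub ((j : ℝ) / n), AddCircle.coe_neg, ← sub_eq_add_neg] at this

theorem mem_arc_iff_halves {n i : ℕ} (hn : 0 < n) {x : UnitAddCircle} :
    x ∈ arc n i ↔ x ∈ arc (2 * n) (2 * i) ∨ x ∈ arc (2 * n) (2 * i + 1) := by
  have hn : (0 : ℝ) < n := by exact_mod_cast hn
  have e1 : ((2 * i : ℕ) : ℝ) / (2 * n : ℕ) = (i : ℝ) / n := by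
    push_cast
    field_simp
  have e2 : (((2 * i + 1 : ℕ) : ℝ) + 1) / (2 * n : ℕ) = ((i : ℝ) + 1) / n := by
    push_cast
    field_simp
    ring
  have e3 : (((2 * i : ℕ) : ℝ) + 1) / (2 * n : ℕ) = ((2 * i + 1 : ℕ) : ℝ) / (2 * n : ℕ) := by
    push_cast
    rfl
  have l1 : ((2 * i : ℕ) : ℝ) / (2 * n : ℕ) ≤ ((2 * i + 1 : ℕ) : ℝ) / (2 * n : ℕ) := by
    gcongr
    simp
  have l2 : ((2 * i + 1 : ℕ) : ℝ) / (2 * n : ℕ) ≤ (((2 * i + 1 : ℕ) : ℝ) + 1) / (2 * n : ℕ) := by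
    gcongr
    simp
  simp only [arc, e3]
  rw [← e1, ← e2]
  constructor
  · rintro ⟨u, ⟨h1, h2⟩, rfl⟩
    rcases lt_or_ge u (((2 * i + 1 : ℕ) : ℝ) / (2 * n : ℕ)) with h | h
    · exact Or.inl ⟨u, ⟨h1, h⟩, rfl⟩
    · exact Or.inr ⟨u, ⟨h, h2⟩, rfl⟩
  · rintro (⟨u, ⟨h1, h2⟩, rfl⟩ | ⟨u, ⟨h1, h2⟩, rfl⟩)
    · exact ⟨u, ⟨h1, h2.trans_le l2⟩, rfl⟩
    · exact ⟨u, ⟨l1.trans h1, h2⟩, rfl⟩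

end

noncomputable section

/-! ### Grid permutations are weak limits of entire diffeomorphisms -/

/-- `x` lies in the preimage of the cell `c` under `(x₁, x₂) ↦ (q x₁, x₂)`. -/
def InCell (k s q : ℕ) (c : Fin k × Fin s) (x : Torus) : Prop :=
  q • x.1 ∈ arc k c.1 ∧ x.2 ∈ arc s c.2

/-- The translation that moves the first component of the preimage of the cell `c` under
`(x₁, x₂) ↦ (q x₁, x₂)` to that of the cell `d`. -/
def shift (k s q : ℕ) (c d : Fin k × Fin s) : Torus :=
  (((((d.1 : ℝ) / k - (c.1 : ℝ) / k) / q : ℝ) : UnitAddCircle),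
    (((d.2 : ℝ) / s - (c.2 : ℝ) / s : ℝ) : UnitAddCircle))

variable {k s q : ℕ}

theorem nsmul_coe_div (hq : q ≠ 0) (t : ℝ) :
    q • ((t / q : ℝ) : UnitAddCircle) = (t : UnitAddCircle) := by
  rw [← AddCircle.coe_nsmul, nsmul_eq_mul, mul_div_cancel₀ _ (by exact_mod_cast hq)]

theorem shift_add_shift (c d e : Fin k × Fin s) :
    shift k s q c d + shift k s q d e = shift k s q c e := by
  simp only [shift, Prod.mk_add_mk, ← AddCircle.coe_add]
  congr 2 <;> ring

theorem shift_self (c : Fin k × Fin s) : shift k s q c c = 0 := by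
  simp [shift]

theorem InCell.add_shift (hq : q ≠ 0) {c : Fin k × Fin s} {x : Torus} (h : InCell k s q c x)
    (d : Fin k × Fin s) : InCell k s q d (x + shift k s q c d) := by
  refine ⟨?_, add_mem_arc _ h.2⟩
  rw [Prod.fst_add, smul_add, shift, nsmul_coe_div hq]
  exact add_mem_arc _ h.1

theorem exists_inCell (hk : 0 < k) (hs : 0 < s) (q : ℕ) (x : Torus) : ∃ c, InCell k s q c x := by
  obtain ⟨i, hi⟩ := exists_mem_arc hk (q • x.1)
  obtain ⟨j, hj⟩ := exists_mem_arc hs x.2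
  exact ⟨(i, j), hi, hj⟩

/-- `h` moves the cells according to `σ`, commuting with `R^{1/q}` and preserving the strip
`[0, 1/q) × 𝕋¹`. -/
def Realizes (k s q : ℕ) (σ : Equiv.Perm (Fin k × Fin s)) (h : Equiv.Perm Torus) : Prop :=
  ∀ c x, InCell k s q c x → h x = x + shift k s q c (σ c)

theorem Realizes.mul (hq : q ≠ 0) {σ τ : Equiv.Perm (Fin k × Fin s)} {h g : Equiv.Perm Torus}
    (hh : Realizes k s q σ h) (hg : Realizes k s q τ g) : Realizes k s q (σ * τ) (h * g) := by
  intro c x hx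
  rw [Equiv.Perm.mul_apply, hg c x hx, hh (τ c) _ (hx.add_shift hq _), add_assoc, shift_add_shift]
  rfl

theorem Realizes.eq_one (hk : 0 < k) (hs : 0 < s) {h : Equiv.Perm Torus}
    (hh : Realizes k s q 1 h) : h = 1 := by
  ext1 x
  obtain ⟨c, hc⟩ := exists_inCell hk hs q x
  rw [hh c x hc, Equiv.Perm.one_apply, shift_self, add_zero, Equiv.Perm.one_apply]

theorem realizes_one : Realizes k s q 1 1 := by
  intro c x _
  simp [shift_self]

theorem colShear_mem_approxGroup' (hq : q ≠ 0) (W : Set UnitAddCircle) (b : UnitAddCircle)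
    (hW : ∃ V, MeasurableSet V ∧ W = {x | q • x ∈ V}) :
    (colShear W b : Equiv.Perm Torus) ∈ approxGroup q := by
  obtain ⟨V, hV, rfl⟩ := hW
  exact colShear_mem_approxGroup hq hV b

/-- Products of 3-cycles are even, so a single transposition of cells is out of reach for them
directly. Cutting row `j` into a lower half `U` and an upper half `U + b` turns it into two
transpositions, which `rowExchange` provides. -/
theorem exists_realizes_swap_row (hq : q ≠ 0) {i i' : Fin k} (hi : i ≠ i') (j : Fin s) :
    ∃ w ∈ approxGroup q, Realizes k s q (Equiv.swap (i, j) (i', j)) w := by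
  have hs : 0 < s := j.pos
  set W : Set UnitAddCircle := {x | q • x ∈ arc k i} with hWdef
  set U : Set UnitAddCircle := arc (2 * s) (2 * j) with hUdef
  set a : UnitAddCircle := ((((i' : ℝ) / k - (i : ℝ) / k) / q : ℝ) : UnitAddCircle) with ha
  set b : UnitAddCircle := ((((2 * j + 1 : ℕ) : ℝ) / (2 * s : ℕ) -
    ((2 * j : ℕ) : ℝ) / (2 * s : ℕ) : ℝ) : UnitAddCircle) with hb
  have hWa (x : UnitAddCircle) : x - a ∈ W ↔ q • x ∈ arc k i' := by
    rw [hWdef, Set.mem_ofPred_eq, smul_sub, ha, nsmul_coe_div hq, sub_mem_arc_iff]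
  have hUb (y : UnitAddCircle) : y - b ∈ U ↔ y ∈ arc (2 * s) (2 * j + 1) := sub_mem_arc_iff _
  have hUU (y : UnitAddCircle) : y ∈ U ∨ y - b ∈ U ↔ y ∈ arc s j := by
    rw [hUb, hUdef, mem_arc_iff_halves hs]
  have hW : ∀ x ∈ W, x - a ∉ W := fun x hx hx' =>
    hi (Fin.ext (eq_of_mem_arc i.2 i'.2 hx ((hWa x).1 hx')))
  have hU : ∀ y ∈ U, y - b ∉ U := fun y hy hy' => by
    have := eq_of_mem_arc (by omega) (by omega) hy ((hUb y).1 hy')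
    omega
  refine ⟨rowExchange W U a b, ?_, ?_⟩
  · refine rowExchange_mem (Q := MeasurableSet) (fun U a hU => rowShear_mem_approxGroup q hU a)
      (colShear_mem_approxGroup' hq) ⟨_, measurableSet_arc i.2, rfl⟩
      (measurableSet_arc (by omega)) ?_
    have : {y | y - b ∈ U} = arc (2 * s) (2 * j + 1) := Set.ext hUb
    rw [this]
    exact measurableSet_arc (by omega)
  · rintro ⟨i₀, j₀⟩ ⟨x, y⟩ ⟨hx, hy⟩
    simp only at hx hy
    by_cases hj : j₀ = j
    · subst hj
      by_cases h1 : i₀ = i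
      · subst h1
        rw [rowExchange_apply_left hW hU hx ((hUU y).2 hy), Equiv.swap_apply_left]
        simp [shift, ha]
      by_cases h2 : i₀ = i'
      · subst h2
        rw [rowExchange_apply_right hW hU ((hWa x).2 hx) ((hUU y).2 hy), Equiv.swap_apply_right, ha,
          sub_eq_add_neg, ← AddCircle.coe_neg, ← neg_div, neg_sub]
        simp [shift]
      · rw [rowExchange_apply_of_notMem, Equiv.swap_apply_of_ne_of_ne (by simp [h1]) (by simp [h2]),
          shift_self, add_zero]
        left
        rw [hWa]
        rintro (h | h)
        · exact h1 (Fin.ext (eq_of_mem_arc i₀.2 i.2 hx h))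
        · exact h2 (Fin.ext (eq_of_mem_arc i₀.2 i'.2 hx h))
    · rw [rowExchange_apply_of_notMem, Equiv.swap_apply_of_ne_of_ne (by simp [hj]) (by simp [hj]),
        shift_self, add_zero]
      right
      rw [hUU]
      exact fun h => hj (Fin.ext (eq_of_mem_arc j₀.2 j.2 hy h))

/-- The same with the column halved. The halves are cut in the coordinate $q x_1$, so `W` and `W +
a` stay $1/q$-periodic. -/
theorem exists_realizes_swap_col (hq : q ≠ 0) (i : Fin k) {j j' : Fin s} (hj : j ≠ j') :
    ∃ w ∈ approxGroup q, Realizes k s q (Equiv.swap (i, j) (i, j')) w := by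
  have hk : 0 < k := i.pos
  set W : Set UnitAddCircle := {x | q • x ∈ arc (2 * k) (2 * i)} with hWdef
  set U : Set UnitAddCircle := arc s j with hUdef
  set a : UnitAddCircle := (((((2 * i + 1 : ℕ) : ℝ) / (2 * k : ℕ) -
    ((2 * i : ℕ) : ℝ) / (2 * k : ℕ)) / q : ℝ) : UnitAddCircle) with ha
  set b : UnitAddCircle := (((j' : ℝ) / s - (j : ℝ) / s : ℝ) : UnitAddCircle) with hb
  have hWa (x : UnitAddCircle) : x - a ∈ W ↔ q • x ∈ arc (2 * k) (2 * i + 1) := by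
    rw [hWdef, Set.mem_ofPred_eq, smul_sub, ha, nsmul_coe_div hq, sub_mem_arc_iff]
  have hUb (y : UnitAddCircle) : y - b ∈ U ↔ y ∈ arc s j' := sub_mem_arc_iff _
  have hWW (x : UnitAddCircle) : x ∈ W ∨ x - a ∈ W ↔ q • x ∈ arc k i := by
    rw [hWa, hWdef, mem_arc_iff_halves hk]
    rfl
  have hU : ∀ y ∈ U, y - b ∉ U := fun y hy hy' =>
    hj (Fin.ext (eq_of_mem_arc j.2 j'.2 hy ((hUb y).1 hy')))
  have hW : ∀ x ∈ W, x - a ∉ W := fun x hx hx' => by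
    have := eq_of_mem_arc (by omega) (by omega) hx ((hWa x).1 hx')
    omega
  refine ⟨colExchange W U a b, ?_, ?_⟩
  · refine colExchange_mem (Q := MeasurableSet) (fun U a hU => rowShear_mem_approxGroup q hU a)
      (colShear_mem_approxGroup' hq) ⟨_, measurableSet_arc (by omega), rfl⟩
      ⟨arc (2 * k) (2 * i + 1), measurableSet_arc (by omega), Set.ext hWa⟩
      (measurableSet_arc j.2) ?_
    have : {y | y - b ∈ U} = arc s j' := Set.ext hUb
    rw [this]
    exact measurableSet_arc j'.2
  · rintro ⟨i₀, j₀⟩ ⟨x, y⟩ ⟨hx, hy⟩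
    simp only at hx hy
    by_cases hi : i₀ = i
    · subst hi
      by_cases h1 : j₀ = j
      · subst h1
        rw [colExchange_apply_bottom hW hU hy ((hWW x).2 hx), Equiv.swap_apply_left]
        simp [shift, hb]
      by_cases h2 : j₀ = j'
      · subst h2
        rw [colExchange_apply_top hW hU ((hUb y).2 hy) ((hWW x).2 hx), Equiv.swap_apply_right, hb,
          sub_eq_add_neg, ← AddCircle.coe_neg, neg_sub]
        simp [shift]
      · rw [colExchange_apply_of_notMem, Equiv.swap_apply_of_ne_of_ne (by simp [h1]) (by simp [h2]),
          shift_self, add_zero]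
        right
        rw [hUb]
        rintro (h | h)
        · exact h1 (Fin.ext (eq_of_mem_arc j₀.2 j.2 hy h))
        · exact h2 (Fin.ext (eq_of_mem_arc j₀.2 j'.2 hy h))
    · rw [colExchange_apply_of_notMem, Equiv.swap_apply_of_ne_of_ne (by simp [hi]) (by simp [hi]),
        shift_self, add_zero]
      left
      rw [hWW]
      exact fun h => hi (Fin.ext (eq_of_mem_arc i₀.2 i.2 hx h))

theorem exists_realizes_swap (hq : q ≠ 0) (c d : Fin k × Fin s) :
    ∃ w ∈ approxGroup q, Realizes k s q (Equiv.swap c d) w := by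
  obtain ⟨i, j⟩ := c
  obtain ⟨i', j'⟩ := d
  rcases eq_or_ne i i' with rfl | hi
  · rcases eq_or_ne j j' with rfl | hj
    · rw [Equiv.swap_self]
      exact ⟨1, one_mem _, realizes_one⟩
    · exact exists_realizes_swap_col hq i hj
  · rcases eq_or_ne j j' with rfl | hj
    · exact exists_realizes_swap_row hq hi j
    · obtain ⟨v, hv, hv'⟩ := exists_realizes_swap_row hq hi j
      obtain ⟨w, hw, hw'⟩ := exists_realizes_swap_col hq i' hj
      -- Conjugating the swap within a row by a swap within a column reaches two cells that share
      -- neither row nor column.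
      have e : Equiv.swap (i', j) (i', j') * Equiv.swap (i, j) (i', j) *
          Equiv.swap (i', j) (i', j') = Equiv.swap (i, j) (i', j') := by
        rw [Equiv.swap_comm (i, j) (i', j), Equiv.swap_comm (i', j) (i', j'),
          Equiv.swap_comm (i', j) (i, j), Equiv.swap_comm (i', j') (i', j),
          Equiv.swap_mul_swap_mul_swap (by simp [hi]) (by simp [hi]), Equiv.swap_comm]
      exact ⟨w * v * w, mul_mem (mul_mem hw hv) hw, e ▸ (hw'.mul hq hv').mul hq hw'⟩

/-- Strip off one transposition at a time. The cells cover the torus, so only the identity map is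
left over the identity permutation. -/
theorem Realizes.mem_approxGroup (hk : 0 < k) (hs : 0 < s) (hq : q ≠ 0)
    {σ : Equiv.Perm (Fin k × Fin s)} {h : Equiv.Perm Torus} (hh : Realizes k s q σ h) :
    h ∈ approxGroup q := by
  induction σ using Equiv.Perm.swap_induction_on generalizing h with
  | one => exact hh.eq_one hk hs ▸ one_mem _
  | swap_mul σ c d hcd ih =>
    obtain ⟨w, hw, hw'⟩ := exists_realizes_swap hq c d
    have := hw'.mul hq hh
    rw [← mul_assoc, Equiv.swap_mul_self, one_mul] at this
    exact (Subgroup.mul_mem_cancel_left _ hw).1 (ih this)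

end

noncomputable section

/-! ### Grid permutations that commute with $R^{1/q}$ and preserve the strip -/

theorem mem_cell_iff {N s : ℕ} {c : Fin N × Fin s} {x : Torus} :
    x ∈ cell N s c ↔ x.1 ∈ arc N c.1 ∧ x.2 ∈ arc s c.2 := by
  constructor
  · rintro ⟨u, hu, v, hv, rfl⟩
    exact ⟨⟨u, hu, rfl⟩, ⟨v, hv, rfl⟩⟩
  · rintro ⟨⟨u, hu, h1⟩, ⟨v, hv, h2⟩⟩
    exact ⟨u, hu, v, hv, Prod.ext h1 h2⟩

theorem measurableSet_cell {N s : ℕ} (c : Fin N × Fin s) : MeasurableSet (cell N s c) := by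
  have : cell N s c = Prod.fst ⁻¹' arc N c.1 ∩ Prod.snd ⁻¹' arc s c.2 :=
    Set.ext fun x => mem_cell_iff
  rw [this]
  exact (measurable_fst (measurableSet_arc c.1.2)).inter (measurable_snd (measurableSet_arc c.2.2))

theorem exists_mem_cell {N s : ℕ} (hN : 0 < N) (hs : 0 < s) (x : Torus) :
    ∃ c, x ∈ cell N s c := by
  obtain ⟨i, hi⟩ := exists_mem_arc hN x.1
  obtain ⟨j, hj⟩ := exists_mem_arc hs x.2
  exact ⟨(i, j), mem_cell_iff.2 ⟨hi, hj⟩⟩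

theorem eq_of_mem_cell {N s : ℕ} {c d : Fin N × Fin s} {x : Torus} (hc : x ∈ cell N s c)
    (hd : x ∈ cell N s d) : c = d := by
  rw [mem_cell_iff] at hc hd
  exact Prod.ext (Fin.ext (eq_of_mem_arc c.1.2 d.1.2 hc.1 hd.1))
    (Fin.ext (eq_of_mem_arc c.2.2 d.2.2 hc.2 hd.2))

/-- The translation that moves the cell `c` to the cell `d`. -/
def cellShift (N s : ℕ) (c d : Fin N × Fin s) : Torus :=
  ((((d.1 : ℝ) / N - (c.1 : ℝ) / N : ℝ) : UnitAddCircle),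
    (((d.2 : ℝ) / s - (c.2 : ℝ) / s : ℝ) : UnitAddCircle))

theorem add_cellShift_mem {N s : ℕ} {c : Fin N × Fin s} {x : Torus} (h : x ∈ cell N s c)
    (d : Fin N × Fin s) : x + cellShift N s c d ∈ cell N s d := by
  rw [mem_cell_iff] at h ⊢
  exact ⟨add_mem_arc _ h.1, add_mem_arc _ h.2⟩

theorem add_cellShift_add_cellShift {N s : ℕ} (c d : Fin N × Fin s) (x : Torus) :
    x + cellShift N s c d + cellShift N s d c = x := by
  have : cellShift N s c d + cellShift N s d c = 0 := by
    simp only [cellShift, Prod.mk_add_mk, ← AddCircle.coe_add, sub_add_sub_cancel, sub_self,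
      AddCircle.coe_zero]
    rfl
  rw [add_assoc, this, add_zero]

theorem image_cell {N s : ℕ} {h : Equiv.Perm Torus} {σ : Equiv.Perm (Fin N × Fin s)}
    (hσ : ∀ c, ∀ x ∈ cell N s c, h x = x + cellShift N s c (σ c)) (c : Fin N × Fin s) :
    h '' cell N s c = cell N s (σ c) := by
  apply Set.Subset.antisymm
  · rintro _ ⟨x, hx, rfl⟩
    rw [hσ c x hx]
    exact add_cellShift_mem hx _
  · intro y hy
    have := add_cellShift_mem hy c
    refine ⟨_, this, ?_⟩
    rw [hσ c _ this, add_cellShift_add_cellShift]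

theorem eq_of_grid {N s : ℕ} (hN : 0 < N) (hs : 0 < s) {h h' : Equiv.Perm Torus}
    {σ : Equiv.Perm (Fin N × Fin s)}
    (hσ : ∀ c, ∀ x ∈ cell N s c, h x = x + cellShift N s c (σ c))
    (hσ' : ∀ c, ∀ x ∈ cell N s c, h' x = x + cellShift N s c (σ c)) : h = h' := by
  ext1 x
  obtain ⟨c, hc⟩ := exists_mem_cell hN hs x
  rw [hσ c x hc, hσ' c x hc]

/-- The cells cover the torus, so the permutation of indices determines the map. This finiteness is
what makes a bound on `l n` uniform over all constructions possible. -/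
theorem finite_isGridPermutation {N s : ℕ} (hN : 0 < N) (hs : 0 < s) :
    {h | IsGridPermutation N s h}.Finite := by
  have : {h | IsGridPermutation N s h} = ⋃ σ : Equiv.Perm (Fin N × Fin s),
      {h | ∀ c, ∀ x ∈ cell N s c, h x = x + cellShift N s c (σ c)} := by
    ext h
    simp [IsGridPermutation, cellShift]
  rw [this]
  exact Set.finite_iUnion fun σ =>
    Set.Subsingleton.finite fun h hh h' hh' => eq_of_grid hN hs hh hh'

theorem mem_strip_of_mem_arc {k q i : ℕ} (hq : 0 < q) (hi : i < k) {x : Torus}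
    (hx : x.1 ∈ arc (k * q) i) : x ∈ strip q := by
  have hk : (0 : ℝ) < k := by exact_mod_cast (Nat.zero_le i).trans_lt hi
  have hq : (0 : ℝ) < q := by exact_mod_cast hq
  obtain ⟨u, ⟨h1, h2⟩, hu⟩ := hx
  refine ⟨u, ⟨le_trans (by positivity) h1, h2.trans_le ?_⟩, hu⟩
  have : (i : ℝ) + 1 ≤ k := by exact_mod_cast hi
  rw [div_le_div_iff₀ (by push_cast; positivity) hq]
  push_cast
  nlinarith

theorem lt_of_mem_arc_of_mem_strip {k q i : ℕ} (hk : 0 < k) (hq : 0 < q) (hi : i < k * q)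
    {x : Torus} (hx : x.1 ∈ arc (k * q) i) (hx' : x ∈ strip q) : i < k := by
  obtain ⟨u, ⟨h1, h2⟩, hu⟩ := hx'
  have hN : 0 < k * q := Nat.mul_pos hk hq
  have hN' : (0 : ℝ) < (k * q : ℕ) := by exact_mod_cast hN
  have hq' : (0 : ℝ) < q := by exact_mod_cast hq
  have h0 : 0 ≤ (k * q : ℕ) * u := by positivity
  have hlt : ⌊(k * q : ℕ) * u⌋₊ < k := by
    rw [Nat.floor_lt h0]
    rw [lt_div_iff₀ hq'] at h2
    have : (0 : ℝ) < k := by exact_mod_cast hk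
    push_cast
    nlinarith
  have hmem : x.1 ∈ arc (k * q) ⌊(k * q : ℕ) * u⌋₊ := by
    refine ⟨u, ?_, hu⟩
    rw [Set.mem_Ico, div_le_iff₀ hN', lt_div_iff₀ hN', mul_comm u]
    exact ⟨Nat.floor_le h0, Nat.lt_floor_add_one _⟩
  rw [eq_of_mem_arc hi (hlt.trans_le (Nat.le_mul_of_pos_right k hq)) hx hmem]
  exact hlt

/-- Each of the `q` components of the preimage of an arc under multiplication by `q` is a translate,
by a multiple of $1/q$, of the one in the first strip. -/
theorem exists_sub_mem_arc {k q i : ℕ} (hq : 0 < q) (hi : i < k) {x : UnitAddCircle}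
    (hx : q • x ∈ arc k i) :
    ∃ m : ℕ, x - (((m : ℝ) / q : ℝ) : UnitAddCircle) ∈ arc (k * q) i := by
  have hk : (0 : ℝ) < k := by exact_mod_cast (Nat.zero_le i).trans_lt hi
  have hq' : (0 : ℝ) < q := by exact_mod_cast hq
  obtain ⟨v, ⟨h1, h2⟩, hv⟩ := hx
  set u : ℝ := (AddCircle.measurableEquivIco 1 0 x : ℝ) with hu
  have h0 : 0 ≤ u := (AddCircle.measurableEquivIco 1 0 x).2.1
  have hux : (u : UnitAddCircle) = x := (AddCircle.equivIco (1 : ℝ) 0).symm_apply_apply x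
  rw [← hux, ← AddCircle.coe_nsmul, ← sub_eq_zero, ← AddCircle.coe_sub,
    AddCircle.coe_eq_zero_iff] at hv
  obtain ⟨m, hm⟩ := hv
  simp only [mul_one, nsmul_eq_mul, zsmul_eq_mul] at hm
  have hv1 : v < 1 := h2.trans_le ((div_le_one hk).2 (by exact_mod_cast hi))
  -- The integer `m` equals `q * u - v` with `u ≥ 0` and `v < 1`, hence exceeds -1.
  have hm0 : 0 ≤ m := by
    have : (-1 : ℝ) < m := by
      rw [hm]
      nlinarith
    have : (-1 : ℤ) < m := by exact_mod_cast this
    omega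
  lift m to ℕ using hm0
  rw [Int.cast_natCast] at hm
  refine ⟨m, v / q, ⟨?_, ?_⟩, ?_⟩
  · rw [Nat.cast_mul, ← div_div]
    gcongr
  · rw [Nat.cast_mul, ← div_div]
    gcongr
  · rw [← hux, ← AddCircle.coe_sub]
    congr 1
    field_simp
    linarith

theorem commute_translation {q : ℕ} {h : Equiv.Perm Torus}
    (hc : ∀ x, h (rot (1 / q) x) = rot (1 / q) (h x)) (m : ℕ) (x : Torus) :
    h (x + ((((m : ℝ) / q : ℝ) : UnitAddCircle), 0)) =
      h x + ((((m : ℝ) / q : ℝ) : UnitAddCircle), 0) := by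
  induction m generalizing x with
  | zero =>
    have e : (((((0 : ℕ) : ℝ) / q : ℝ) : UnitAddCircle), (0 : UnitAddCircle)) = (0 : Torus) := by
      simp only [Nat.cast_zero, zero_div, AddCircle.coe_zero]
      rfl
    rw [e, add_zero, add_zero]
  | succ m ih =>
    have e : (((((m + 1 : ℕ) : ℝ) / q : ℝ) : UnitAddCircle), (0 : UnitAddCircle)) =
        ((((m : ℝ) / q : ℝ) : UnitAddCircle), 0) + (((1 / q : ℝ) : UnitAddCircle), 0) := by
      rw [Prod.mk_add_mk, ← AddCircle.coe_add, add_zero]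
      congr 2
      push_cast
      ring
    have h1 := hc (x + ((((m : ℝ) / q : ℝ) : UnitAddCircle), 0))
    rw [ih] at h1
    rw [e, ← add_assoc, ← add_assoc]
    exact h1

/-- Invariance of the strip makes the index permutation map the first `k` columns to themselves, and
commutation with $R^{1/q}$ carries its action there to the other strips. -/
theorem IsGridPermutation.exists_realizes {k s q : ℕ} (hk : 0 < k) (hs : 0 < s) (hq : 0 < q)
    {h : Equiv.Perm Torus} (hg : IsGridPermutation (k * q) s h)
    (hc : ∀ x, h (rot (1 / q) x) = rot (1 / q) (h x)) (hu : h '' strip q = strip q) :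
    ∃ σ, Realizes k s q σ h := by
  obtain ⟨σ, hσ⟩ := hg
  replace hσ : ∀ c, ∀ x ∈ cell (k * q) s c, h x = x + cellShift (k * q) s c (σ c) := hσ
  have hkq : k ≤ k * q := Nat.le_mul_of_pos_right k hq
  let e : Fin k × Fin s → Fin (k * q) × Fin s := fun c => (Fin.castLE hkq c.1, c.2)
  have he : Function.Injective e := fun c d hcd => by
    simp only [e, Prod.mk.injEq, Fin.castLE_inj] at hcd
    exact Prod.ext hcd.1 hcd.2
  have hlt : ∀ c, ((σ (e c)).1 : ℕ) < k := fun c => by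
    -- The lower left corner of the cell is a test point: its image lies both in the strip and in
    -- the image cell, which locates the column of the latter.
    let x : Torus := (((((c.1 : ℕ) : ℝ) / (k * q : ℕ) : ℝ) : UnitAddCircle),
      ((((c.2 : ℕ) : ℝ) / s : ℝ) : UnitAddCircle))
    have hkq' : (0 : ℝ) < (k * q : ℕ) := by exact_mod_cast Nat.mul_pos hk hq
    have hs' : (0 : ℝ) < s := by exact_mod_cast hs
    have hx : x ∈ cell (k * q) s (e c) := by
      refine mem_cell_iff.2 ⟨⟨_, ⟨le_rfl, ?_⟩, rfl⟩, ⟨_, ⟨le_rfl, ?_⟩, rfl⟩⟩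
      · have : ((e c).1 : ℕ) = c.1 := rfl
        rw [this]
        gcongr
        linarith
      · have : ((e c).2 : ℕ) = c.2 := rfl
        rw [this]
        gcongr
        linarith
    have hxs : x ∈ strip q := mem_strip_of_mem_arc hq c.1.2 (mem_cell_iff.1 hx).1
    have hhx : h x ∈ strip q := hu ▸ Set.mem_image_of_mem h hxs
    have hhx' : h x ∈ cell (k * q) s (σ (e c)) := image_cell hσ (e c) ▸ Set.mem_image_of_mem h hx
    exact lt_of_mem_arc_of_mem_strip hk hq (σ (e c)).1.2 (mem_cell_iff.1 hhx').1 hhx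
  let f : Fin k × Fin s → Fin k × Fin s := fun c => (⟨_, hlt c⟩, (σ (e c)).2)
  have hef : ∀ c, e (f c) = σ (e c) := fun c => rfl
  have hf : Function.Injective f := fun c d hcd => by
    refine he (σ.injective ?_)
    rw [← hef, ← hef, hcd]
  refine ⟨Equiv.ofBijective f hf.bijective_of_finite, fun c x hx => ?_⟩
  obtain ⟨m, hm⟩ := exists_sub_mem_arc hq c.1.2 hx.1
  set t : Torus := ((((m : ℝ) / q : ℝ) : UnitAddCircle), 0) with ht
  have hx0 : x - t ∈ cell (k * q) s (e c) := mem_cell_iff.2 ⟨hm, by simpa [ht] using hx.2⟩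
  have h1 := hσ _ _ hx0
  have h2 := commute_translation hc m (x - t)
  rw [← ht, sub_add_cancel, h1] at h2
  have h3 : cellShift (k * q) s (e c) (σ (e c)) = shift k s q c (f c) := by
    rw [cellShift, shift]
    congr 2
    change (((σ (e c)).1 : ℕ) : ℝ) / (k * q : ℕ) - ((c.1 : ℕ) : ℝ) / (k * q : ℕ) =
      ((((σ (e c)).1 : ℕ) : ℝ) / k - ((c.1 : ℕ) : ℝ) / k) / q
    push_cast
    rw [sub_div, div_div, div_div]
  rw [h2, h3, Equiv.ofBijective_apply]
  abel

theorem IsGridPermutation.mem_approxGroup {k s q : ℕ} (hk : 0 < k) (hs : 0 < s) (hq : 0 < q)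
    {h : Equiv.Perm Torus} (hg : IsGridPermutation (k * q) s h)
    (hc : ∀ x, h (rot (1 / q) x) = rot (1 / q) (h x)) (hu : h '' strip q = strip q) :
    h ∈ approxGroup q := by
  obtain ⟨σ, hσ⟩ := hg.exists_realizes hk hs hq hc hu
  exact hσ.mem_approxGroup hk hs hq.ne'

end

noncomputable section

/-! ### Choice of the approximating diffeomorphisms -/

/-- `g` is a diffeomorphism that approximates `h` so well that passing from `H`, `G` to `h ∘ H`,
`g ∘ G` changes the maps `G⁻¹ ∘ H` and `H⁻¹ ∘ G` by less than `δ` outside a set of measure `δ`. -/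
structure IsApproximant (δ ε : ℝ) (N s q : ℕ) (h H : Equiv.Perm Torus) (G g : Torus ≃ₜ Torus) :
    Prop where
  mem : g ∈ entireCentralizer q
  approx : EpsApproximates ε N s q g h
  conj : volume {x | δ ≤ dist ((g * G)⁻¹ ((h * H) x)) (G⁻¹ (H x))} ≤ ENNReal.ofReal δ
  conj_symm : volume {x | δ ≤ dist ((h * H)⁻¹ ((g * G) x)) (H⁻¹ (G x))} ≤ ENNReal.ofReal δ

theorem epsApproximates_of_measure_lt {ε : ℝ} {N s q : ℕ} (hN : 0 < N) (hs : 0 < s)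
    {h : Equiv.Perm Torus} (hg : IsGridPermutation N s h) {g : Torus ≃ₜ Torus}
    (hgq : g ∈ entireCentralizer q)
    (hε : ∑ c : Fin N × Fin s, volume ((g ⁻¹' (h '' cell N s c)) ∆ (h ⁻¹' (h '' cell N s c))) <
      ENNReal.ofReal ε) : EpsApproximates ε N s q g h := by
  have hm (c : Fin N × Fin s) : MeasurableSet (h '' cell N s c) := by
    obtain ⟨σ, hσ⟩ := hg
    rw [image_cell hσ]
    exact measurableSet_cell _
  set L : Set Torus := ⋃ c, cell N s c ∩ g ⁻¹' (h '' cell N s c) with hL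
  have hLm : MeasurableSet L := MeasurableSet.iUnion fun c =>
    (measurableSet_cell c).inter (g.continuous.measurable (hm c))
  refine ⟨⟨L, hLm, ?_, ?_⟩, fun x => ?_⟩
  -- A point outside `L` lies in some cell $c = h^{-1}(h(c))$ but not in $g^{-1}(h(c))$.
  · have hsub : Lᶜ ⊆ ⋃ c ∈ (Finset.univ : Finset (Fin N × Fin s)),
        (g ⁻¹' (h '' cell N s c)) ∆ (h ⁻¹' (h '' cell N s c)) := by
      intro x hx
      obtain ⟨c, hc⟩ := exists_mem_cell hN hs x
      refine Set.mem_iUnion₂.2 ⟨c, Finset.mem_univ _, Or.inr ⟨⟨x, hc, rfl⟩, fun hx' => hx ?_⟩⟩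
      exact Set.mem_iUnion.2 ⟨c, hc, hx'⟩
    have hlt : volume Lᶜ < ENNReal.ofReal ε :=
      ((measure_mono hsub).trans (measure_biUnion_finset_le _ _)).trans_lt hε
    have h1 : volume.real Lᶜ < ε := by
      have hε0 : 0 < ε := ENNReal.ofReal_pos.1 (bot_le.trans_lt hlt)
      rw [Measure.real, ← ENNReal.toReal_ofReal hε0.le]
      exact (ENNReal.toReal_lt_toReal (measure_ne_top _ _) ENNReal.ofReal_ne_top).2 hlt
    rw [probReal_compl_eq_one_sub hLm] at h1
    linarith
  · rintro c x ⟨hx, hxc⟩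
    obtain ⟨d, hd, hd'⟩ := Set.mem_iUnion.1 hx
    rw [eq_of_mem_cell hxc hd]
    exact hd'
  · have := (commute_rot_of_mem_entireCentralizer hgq 1).eq
    rw [Nat.cast_one] at this
    exact DFunLike.congr_fun this x

/-- Along a sequence $g_n \to h$ the maps $G^{-1}g_n^{-1}hH$ and $H^{-1}h^{-1}g_nG$ converge in
measure to $G^{-1}H$ and $H^{-1}G$. All requirements therefore hold for large indices. -/
theorem exists_isApproximant {δ ε : ℝ} (hδ : 0 < δ) (hε : 0 < ε) {N s q : ℕ} (hN : 0 < N)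
    (hs : 0 < s) {h H : Equiv.Perm Torus} {G : Torus ≃ₜ Torus} (hh : h ∈ approxGroup q)
    (hg : IsGridPermutation N s h) (hH : PreservesVolume H) (hH' : Measurable H.symm)
    (hG : PreservesVolume G) : ∃ g, IsApproximant δ ε N s q h H G g := by
  obtain ⟨ph, mh, g, hgq, hgh⟩ := hh
  have pg (n : ℕ) := preservesVolume_of_mem_entireCentralizer (hgq n)
  have hm (c : Fin N × Fin s) : MeasurableSet (h '' cell N s c) := by
    obtain ⟨σ, hσ⟩ := hg
    rw [image_cell hσ]
    exact measurableSet_cell _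
  have hgs : WeaklyTendsto (fun n => (g n).symm) h.symm :=
    WeaklyTendsto.symm (F := fun n => (g n).toEquiv) hgh pg
      (fun n => (g n).symm.continuous.measurable) mh
  have e1 : ∀ᶠ n in atTop, EpsApproximates ε N s q (g n) h := by
    have : Tendsto (fun n => ∑ c : Fin N × Fin s, volume ((g n ⁻¹' (h '' cell N s c)) ∆
        (h ⁻¹' (h '' cell N s c)))) atTop (𝓝 0) := by
      have := tendsto_finsetSum Finset.univ fun c (_ : c ∈ (Finset.univ : Finset (Fin N × Fin s))) =>
        hgh _ (hm c)
      simpa using this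
    filter_upwards [this.eventually (gt_mem_nhds (ENNReal.ofReal_pos.2 hε))] with n hn
    exact epsApproximates_of_measure_lt hN hs hg (hgq n) hn
  have e2 : ∀ᶠ n in atTop, volume {x | δ ≤ dist ((g n * G)⁻¹ ((h * H) x)) (G⁻¹ (H x))} ≤
      ENNReal.ofReal δ := by
    have hw : WeaklyTendsto (fun n => (G.symm ∘ (g n).symm) ∘ (h ∘ H)) ((G.symm ∘ h.symm) ∘ (h ∘ H)) :=
      ((weaklyTendsto_const G.symm).comp hgs (fun _ => G.symm.continuous.measurable)
        G.symm.continuous.measurable (fun n => (pg n).homeo_symm)).comp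
        (weaklyTendsto_const (h ∘ H))
        (fun n => G.symm.continuous.measurable.comp (g n).symm.continuous.measurable)
        (G.symm.continuous.measurable.comp mh) (fun _ => ph.comp hH)
    have ht := hw.tendstoInMeasure
    rw [tendstoInMeasure_iff_dist] at ht
    filter_upwards [ENNReal.tendsto_nhds_zero.1 (ht δ hδ) _ (ENNReal.ofReal_pos.2 hδ)] with n hn
    refine le_of_eq_of_le ?_ hn
    congr 1
    ext x
    have : ((G.symm ∘ h.symm) ∘ (h ∘ H)) x = G.symm (H x) := by simp
    rw [Set.mem_ofPred_eq, Set.mem_ofPred_eq, this]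
    rfl
  have e3 : ∀ᶠ n in atTop, volume {x | δ ≤ dist ((h * H)⁻¹ ((g n * G) x)) (H⁻¹ (G x))} ≤
      ENNReal.ofReal δ := by
    have hw : WeaklyTendsto (fun n => (H.symm ∘ h.symm) ∘ (g n ∘ G)) ((H.symm ∘ h.symm) ∘ (h ∘ G)) :=
      (weaklyTendsto_const (H.symm ∘ h.symm)).comp
        (hgh.comp (weaklyTendsto_const G) (fun n => (g n).continuous.measurable) ph.measurable
          (fun _ => hG)) (fun _ => hH'.comp mh) (hH'.comp mh) (fun n => (pg n).comp hG)
    have ht := hw.tendstoInMeasure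
    rw [tendstoInMeasure_iff_dist] at ht
    filter_upwards [ENNReal.tendsto_nhds_zero.1 (ht δ hδ) _ (ENNReal.ofReal_pos.2 hδ)] with n hn
    refine le_of_eq_of_le ?_ hn
    congr 1
    ext x
    have : ((H.symm ∘ h.symm) ∘ (h ∘ G)) x = H.symm (G x) := by simp
    rw [Set.mem_ofPred_eq, Set.mem_ofPred_eq, this]
    rfl
  obtain ⟨n, h1, h2, h3⟩ := (e1.and (e2.and e3)).exists
  exact ⟨g n, hgq n, h1, h2, h3⟩

/-! ### The limit conjugacy -/

/-- By Borel–Cantelli almost every orbit of values is eventually geometrically Cauchy; the pointwise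
limit preserves the measure and is also the weak limit. -/
theorem exists_weaklyTendsto {F : ℕ → Torus → Torus} (pF : ∀ n, PreservesVolume (F n))
    (h : ∀ n, volume {x | (1 / 2 : ℝ) ^ n ≤ dist (F (n + 1) x) (F n x)} ≤
      ENNReal.ofReal ((1 / 2) ^ n)) :
    ∃ f, PreservesVolume f ∧ WeaklyTendsto F f := by
  have hsum : ∑' n, volume {x | (1 / 2 : ℝ) ^ n ≤ dist (F (n + 1) x) (F n x)} ≠ ⊤ := by
    refine ne_top_of_le_ne_top ?_ (ENNReal.tsum_le_tsum h)
    rw [← ENNReal.ofReal_tsum_of_nonneg (fun n => by positivity) summable_geometric_two]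
    exact ENNReal.ofReal_ne_top
  have hae : ∀ᵐ x, ∃ l, Tendsto (fun n => F n x) atTop (𝓝 l) := by
    filter_upwards [ae_eventually_notMem hsum] with x hx
    obtain ⟨N, hN⟩ := eventually_atTop.1 hx
    refine cauchySeq_tendsto_of_complete ((cauchySeq_shift N).1 ?_)
    refine cauchySeq_of_le_geometric (1 / 2) ((1 / 2) ^ N) (by norm_num) fun n => ?_
    have := hN (n + N) (Nat.le_add_left _ _)
    simp only [not_le] at this
    rw [dist_comm, ← pow_add, add_comm N n, add_right_comm]
    exact this.le
  obtain ⟨f, mf, hf⟩ := measurable_limit_of_tendsto_metrizable_ae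
    (fun n => (pF n).measurable.aemeasurable) hae
  have pf := preservesVolume_of_tendsto_ae pF mf hf
  exact ⟨f, pf, weaklyTendsto_of_tendsto_ae pF pf hf⟩

/-- The exact identities between $G_n^{-1}H_n$, its inverse, $T_n$ and $S_n$ pass to the weak limit
by continuity of composition and almost everywhere uniqueness of limits. The inverses have their own
hypothesis `h2`, which gives the limit `ψ`. -/
theorem measureIsomorphic_of_conj {H : ℕ → Equiv.Perm Torus} {G : ℕ → Torus ≃ₜ Torus}
    {R : ℕ → Torus ≃ₜ Torus} {T : Torus → Torus} {S : Torus ≃ₜ Torus}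
    (pH : ∀ n, PreservesVolume (H n)) (mH : ∀ n, Measurable (H n).symm)
    (pG : ∀ n, PreservesVolume (G n)) (pR : ∀ n, PreservesVolume (R n))
    (h1 : ∀ n, volume {x | (1 / 2 : ℝ) ^ n ≤ dist ((G (n + 1))⁻¹ (H (n + 1) x)) ((G n)⁻¹ (H n x))} ≤
      ENNReal.ofReal ((1 / 2) ^ n))
    (h2 : ∀ n, volume {x | (1 / 2 : ℝ) ^ n ≤ dist ((H (n + 1))⁻¹ (G (n + 1) x)) ((H n)⁻¹ (G n x))} ≤
      ENNReal.ofReal ((1 / 2) ^ n))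
    (hT : WeaklyTendsto (fun n => (H n)⁻¹ * (R n).toEquiv * H n) T)
    (pS : PreservesVolume S)
    (hS : ∀ x, Tendsto (fun n => ((G n)⁻¹ * R n * G n) x) atTop (𝓝 (S x))) :
    MeasureIsomorphic T S := by
  have pH' (n : ℕ) : PreservesVolume (H n).symm := (pH n).perm_symm (mH n)
  have pG' (n : ℕ) : PreservesVolume (G n).symm := (pG n).homeo_symm
  have pF (n : ℕ) : PreservesVolume ((G n).symm ∘ H n) := (pG' n).comp (pH n)
  have pE (n : ℕ) : PreservesVolume ((H n).symm ∘ G n) := (pH' n).comp (pG n)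
  have pTn (n : ℕ) : PreservesVolume ((H n)⁻¹ * (R n).toEquiv * H n : Equiv.Perm Torus) :=
    ((pH' n).comp (pR n)).comp (pH n)
  have pSn (n : ℕ) : PreservesVolume ((G n)⁻¹ * R n * G n : Torus ≃ₜ Torus) :=
    ((pG' n).comp (pR n)).comp (pG n)
  obtain ⟨φ, pφ, hφ⟩ := exists_weaklyTendsto pF h1
  obtain ⟨ψ, pψ, hψ⟩ := exists_weaklyTendsto pE h2
  have hSw : WeaklyTendsto (fun n => ((G n)⁻¹ * R n * G n : Torus ≃ₜ Torus)) S :=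
    weaklyTendsto_of_tendsto_ae pSn pS (.of_forall hS)
  refine ⟨φ, ψ, pφ, pψ, ?_, ?_, ?_⟩
  · refine (hψ.comp hφ (fun n => (pE n).measurable) pψ.measurable pF).ae_unique (g := id) ?_
    refine (weaklyTendsto_const id).congr_fun fun n => ?_
    ext1 x
    simp
  · refine (hφ.comp hψ (fun n => (pF n).measurable) pφ.measurable pE).ae_unique (g := id) ?_
    refine (weaklyTendsto_const id).congr_fun fun n => ?_
    ext1 x
    simp
  · refine (hφ.comp hT (fun n => (pF n).measurable) pφ.measurable pTn).ae_unique (g := S ∘ φ) ?_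
    refine (hSw.comp hφ (fun n => (pSn n).measurable) pS.measurable pF).congr_fun fun n => ?_
    ext1 x
    change (G n).symm (R n (G n ((G n).symm (H n x)))) =
      (G n).symm (H n ((H n).symm (R n (H n x))))
    simp

end

noncomputable section

/-! ### Estimates for conjugates of rotations -/

/-- Schwarz lemma on the ball of radius 2 about `z`: it fits into the wider band, contains the
shifted point, and is mapped into a ball of radius `2 * B`, so the Lipschitz factor is `B`. -/
theorem norm_sub_le_of_bounded_on_band {ρ B t : ℝ} {g : ℂ × ℂ → ℂ}
    (hg : DifferentiableOn ℂ g (band (ρ + 2))) (hB : ∀ z ∈ band (ρ + 2), ‖g z‖ ≤ B)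
    {z : ℂ × ℂ} (hz : z ∈ band ρ) (ht : |t| ≤ 1) :
    ‖g (z.1 + t, z.2) - g z‖ ≤ B * |t| := by
  have hsub : Metric.ball z 2 ⊆ band (ρ + 2) := by
    intro w hw
    rw [Metric.mem_ball, Prod.dist_eq, max_lt_iff, Complex.dist_eq, Complex.dist_eq] at hw
    have h1 := (Complex.abs_im_le_norm _).trans_lt hw.1
    have h2 := (Complex.abs_im_le_norm _).trans_lt hw.2
    rw [Complex.sub_im] at h1 h2
    constructor
    · have := abs_sub_abs_le_abs_sub w.1.im z.1.im
      have := hz.1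
      linarith
    · have := abs_sub_abs_le_abs_sub w.2.im z.2.im
      have := hz.2
      linarith
  have hd : dist (z.1 + (t : ℂ), z.2) z = |t| := by
    rw [Prod.dist_eq]
    simp
  have h := Complex.dist_le_div_mul_dist_of_mapsTo_ball (R₂ := 2 * B) (hg.mono hsub) (fun w hw => ?_)
    (show (z.1 + (t : ℂ), z.2) ∈ Metric.ball z 2 by rw [Metric.mem_ball, hd]; linarith)
  · rw [hd, mul_div_cancel_left₀ _ two_ne_zero, dist_eq_norm] at h
    exact h
  · rw [Metric.mem_closedBall, dist_eq_norm]
    have h1 := hB w (hsub hw)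
    have h2 := hB z (hsub (Metric.mem_ball_self two_pos))
    exact (norm_sub_le _ _).trans (by linarith)

/-- `f` and `g` have lifts whose displacements differ by at most `C` on the band. -/
def LiftsWithin (ρ C : ℝ) (f g : Torus → Torus) : Prop :=
  ∃ f₁ f₂ g₁ g₂ : ℂ × ℂ → ℂ, IsAnalyticLift ρ f f₁ f₂ ∧ IsAnalyticLift ρ g g₁ g₂ ∧
    (∀ z ∈ band ρ, ‖g₁ z - f₁ z‖ ≤ C) ∧ ∀ z ∈ band ρ, ‖g₂ z - f₂ z‖ ≤ C

theorem LiftsWithin.mono {ρ C D : ℝ} {f g : Torus → Torus} (h : LiftsWithin ρ C f g) (hCD : C ≤ D) :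
    LiftsWithin ρ D f g := by
  obtain ⟨f₁, f₂, g₁, g₂, hf, hg, h1, h2⟩ := h
  exact ⟨f₁, f₂, g₁, g₂, hf, hg, fun z hz => (h1 z hz).trans hCD, fun z hz => (h2 z hz).trans hCD⟩

theorem exists_conj_rot_liftsWithin (ρ : ℝ) {H : Torus ≃ₜ Torus} (hH : H ∈ entireGroup) :
    ∃ C : ℕ, ∀ s t : ℝ, |t| ≤ 1 →
      LiftsWithin ρ (C * |t|) (H⁻¹ * rot s * H : Torus ≃ₜ Torus)
        (H⁻¹ * rot (s + t) * H : Torus ≃ₜ Torus) := by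
  obtain ⟨-, ⟨f₁, f₂, hf⟩, ⟨g₁, g₂, hg⟩⟩ := hH
  obtain ⟨A, hA, hA1, hA2⟩ := (hf ρ).exists_bound
  obtain ⟨B, hB, hB1, hB2⟩ := (hg (ρ + A + 2)).exists_bound
  -- The summand 1 accounts for the change of the rotation itself, `B` for the change of the
  -- displacement of $H^{-1}$. Real translations preserve bands, so neither depends on `s`.
  obtain ⟨C, hC⟩ := exists_nat_ge (1 + B)
  refine ⟨C, fun s t ht => ?_⟩
  have hl (s : ℝ) := IsAnalyticLift.comp hg
    (IsAnalyticLift.comp (fun ρ => isAnalyticLift_rot ρ s) (hf ρ))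
  refine ⟨_, _, _, _, hl s, hl (s + t), ?_⟩
  have key (z) (hz : z ∈ band ρ) (g : ℂ × ℂ → ℂ) (hg : DifferentiableOn ℂ g (band (ρ + A + 2)))
      (hB' : ∀ z ∈ band (ρ + A + 2), ‖g z‖ ≤ B) :
      ‖g (displace (fun z => f₁ z + ((s + t : ℝ) : ℂ)) (fun z => f₂ z + 0) z) -
        g (displace (fun z => f₁ z + (s : ℂ)) (fun z => f₂ z + 0) z)‖ ≤ B * |t| := by
    have hw : displace (fun z => f₁ z + (s : ℂ)) (fun z => f₂ z + 0) z ∈ band (ρ + A) := by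
      have := displace_mapsTo_band hA1 hA2 hz
      simpa [displace, band] using this
    have := norm_sub_le_of_bounded_on_band hg hB' hw ht
    convert this using 4
    simp only [displace, Prod.mk.injEq, and_true]
    push_cast
    ring
  have hC' : |t| + B * |t| ≤ C * |t| := by
    have := mul_le_mul_of_nonneg_right hC (abs_nonneg t)
    linarith
  constructor
  · intro z hz
    have h := key z hz g₁ (hg _).fst_mem.holomorphic hB1
    set a := g₁ (displace (fun z => f₁ z + ((s + t : ℝ) : ℂ)) (fun z => f₂ z + 0) z)
    set b := g₁ (displace (fun z => f₁ z + (s : ℂ)) (fun z => f₂ z + 0) z)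
    have e : f₁ z + ((s + t : ℝ) : ℂ) + a - (f₁ z + (s : ℂ) + b) = (t : ℂ) + (a - b) := by
      push_cast
      ring
    rw [e]
    refine (norm_add_le _ _).trans (le_trans (add_le_add ?_ h) hC')
    simp
  · intro z hz
    have h := key z hz g₂ (hg _).snd_mem.holomorphic hB2
    set a := g₂ (displace (fun z => f₁ z + ((s + t : ℝ) : ℂ)) (fun z => f₂ z + 0) z)
    set b := g₂ (displace (fun z => f₁ z + (s : ℂ)) (fun z => f₂ z + 0) z)
    have e : f₂ z + 0 + a - (f₂ z + 0 + b) = a - b := by ring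
    rw [e]
    have := abs_nonneg t
    linarith

/-! ### Limits in `Diff^ω_ρ` -/

/-- The limit is a telescoping series. Its terms are geometrically small on the band, so by Cauchy
estimates their derivatives are summable locally uniformly and the sum is holomorphic. -/
theorem exists_isCOmega_limit {ρ : ℝ} (hρ : 0 < ρ) {u : ℕ → ℂ × ℂ → ℂ}
    (hu : ∀ n, IsCOmega ρ (u n))
    (h : ∀ n, ∀ z ∈ band ρ, ‖u (n + 1) z - u n z‖ ≤ (1 / 2) ^ n) :
    ∃ v, IsCOmega ρ v ∧ ∀ n, ∀ z ∈ band ρ, ‖u n z - v z‖ ≤ 2 * (1 / 2) ^ n := by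
  have hle (z) (hz : z ∈ band ρ) (n : ℕ) : dist (u n z) (u (n + 1) z) ≤ 1 * (1 / 2) ^ n := by
    rw [dist_comm, dist_eq_norm, one_mul]
    exact h n z hz
  have hsum (z) (hz : z ∈ band ρ) : Summable fun n => u (n + 1) z - u n z :=
    Summable.of_norm_bounded summable_geometric_two (fun n => h n z hz)
  set v : ℂ × ℂ → ℂ := fun z => u 0 z + ∑' n, (u (n + 1) z - u n z) with hv
  have hlim (z) (hz : z ∈ band ρ) : Tendsto (fun n => u n z) atTop (𝓝 (v z)) := by
    have := ((hsum z hz).hasSum.tendsto_sum_nat).const_add (u 0 z)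
    refine this.congr fun n => ?_
    rw [Finset.sum_range_sub (fun n => u n z)]
    ring
  have hdist (n : ℕ) (z) (hz : z ∈ band ρ) : ‖u n z - v z‖ ≤ 2 * (1 / 2) ^ n := by
    have := dist_le_of_le_geometric_of_tendsto (1 / 2) 1 (by norm_num) (hle z hz) (hlim z hz) n
    have e : 1 * (1 / 2 : ℝ) ^ n / (1 - 1 / 2) = 2 * (1 / 2) ^ n := by ring
    rwa [dist_eq_norm, e] at this
  have hreal (x y : ℝ) : ((x : ℂ), (y : ℂ)) ∈ band ρ := by simp [band, hρ]
  refine ⟨v, ⟨?_, ?_, ?_, ?_⟩, hdist⟩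
  · intro z₀ hz₀
    obtain ⟨r, hr, hball⟩ := Metric.isOpen_iff.1 (isOpen_band ρ) z₀ hz₀
    have hsub : ∀ x ∈ Metric.ball z₀ (r / 2), Metric.ball x (r / 2) ⊆ band ρ := fun x hx =>
      (Metric.ball_subset_ball' (by rw [Metric.mem_ball] at hx; linarith)).trans hball
    have hx0 : z₀ ∈ Metric.ball z₀ (r / 2) := Metric.mem_ball_self (by positivity)
    have hdiff (n : ℕ) : DifferentiableOn ℂ (fun z => u (n + 1) z - u n z) (band ρ) :=
      ((hu _).sub (hu _)).holomorphic
    have hder := hasFDerivAt_tsum_of_isPreconnected (𝕜 := ℂ)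
      (f := fun n z => u (n + 1) z - u n z)
      (f' := fun n z => fderiv ℂ (fun z => u (n + 1) z - u n z) z)
      (u := fun n => 2 * (1 / 2 : ℝ) ^ n / (r / 2)) (x₀ := z₀) (x := z₀)
      ((summable_geometric_two.mul_left 2).div_const _)
      (Metric.isOpen_ball (x := z₀) (ε := r / 2))
      (convex_ball z₀ (r / 2)).isPreconnected
      (fun n x hx => ((hdiff n).differentiableAt ((isOpen_band ρ).mem_nhds
        (hsub x hx (Metric.mem_ball_self (by positivity))))).hasFDerivAt)
      (fun n x hx => ?_) hx0 (hsum z₀ hz₀) hx0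
    · exact (((hu 0).holomorphic.differentiableAt ((isOpen_band ρ).mem_nhds hz₀)).add
        hder.differentiableAt).differentiableWithinAt
    · refine Complex.norm_fderiv_le_div_of_mapsTo_ball ((hdiff n).mono (hsub x hx)) (fun w hw => ?_)
        (by positivity)
      rw [Metric.mem_closedBall, dist_eq_norm]
      have h1 := h n w (hsub x hx hw)
      have h2 := h n x (hsub x hx (Metric.mem_ball_self (by positivity)))
      exact (norm_sub_le _ _).trans (by linarith)
  · obtain ⟨C, hC, hb⟩ := bandNorm_lt_top_iff.1 (hu 0).bounded
    refine bandNorm_lt_top_iff.2 ⟨C + 2, by positivity, fun z hz => ?_⟩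
    have h1 := hb z hz
    have h2 := hdist 0 z hz
    rw [pow_zero, mul_one, ← norm_neg, neg_sub] at h2
    calc ‖v z‖ = ‖u 0 z + (v z - u 0 z)‖ := by ring_nf
      _ ≤ _ := (norm_add_le _ _).trans (add_le_add h1 h2)
  · intro x y
    have := (Complex.continuous_im.tendsto _).comp (hlim _ (hreal x y))
    refine tendsto_nhds_unique this (tendsto_const_nhds.congr fun n => ?_)
    exact ((hu n).real x y).symm
  · intro x y m n
    refine tendsto_nhds_unique (hlim _ (hreal _ _)) ((hlim _ (hreal x y)).congr fun i => ?_)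
    rw [(hu i).periodic]

theorem coe_add_sub_of_coe_eq {a b c : ℝ} (h : (a : UnitAddCircle) = b) :
    ((a + (c - b) : ℝ) : UnitAddCircle) = c := by
  rw [AddCircle.coe_add, h, ← AddCircle.coe_add, add_sub_cancel]

/-- Each comparison of consecutive maps comes with its own lifts. Transporting the difference to a
lift already in hand makes all of them belong to one coherent sequence. -/
theorem IsAnalyticLift.add_sub {ρ : ℝ} {f g : Torus → Torus} {u₁ u₂ f₁ f₂ g₁ g₂ : ℂ × ℂ → ℂ}
    (hu : IsAnalyticLift ρ f u₁ u₂) (hf : IsAnalyticLift ρ f f₁ f₂)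
    (hg : IsAnalyticLift ρ g g₁ g₂) :
    IsAnalyticLift ρ g (fun z => u₁ z + (g₁ z - f₁ z)) (fun z => u₂ z + (g₂ z - f₂ z)) where
  fst_mem := hu.fst_mem.add (hg.fst_mem.sub hf.fst_mem)
  snd_mem := hu.snd_mem.add (hg.snd_mem.sub hf.snd_mem)
  lift x y := by
    have h := (hu.lift x y).symm.trans (hf.lift x y)
    rw [Prod.mk.injEq] at h
    rw [hg.lift]
    congr 1
    · have e : x + (u₁ (x, y) + (g₁ (x, y) - f₁ (x, y))).re =
          (x + (u₁ (x, y)).re) + ((x + (g₁ (x, y)).re) - (x + (f₁ (x, y)).re)) := by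
        simp only [Complex.add_re, Complex.sub_re]
        ring
      rw [e]
      exact (coe_add_sub_of_coe_eq h.1).symm
    · have e : y + (u₂ (x, y) + (g₂ (x, y) - f₂ (x, y))).re =
          (y + (u₂ (x, y)).re) + ((y + (g₂ (x, y)).re) - (y + (f₂ (x, y)).re)) := by
        simp only [Complex.add_re, Complex.sub_re]
        ring
      rw [e]
      exact (coe_add_sub_of_coe_eq h.2).symm

theorem dist_coe_le (x y : ℝ) : dist (x : UnitAddCircle) (y : UnitAddCircle) ≤ |x - y| := by
  rw [dist_eq_norm, ← AddCircle.coe_sub]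
  exact QuotientAddGroup.norm_mk_le_norm

theorem IsAnalyticLift.dist_le {ρ C : ℝ} (hρ : 0 < ρ) {f g : Torus → Torus}
    {f₁ f₂ g₁ g₂ : ℂ × ℂ → ℂ}
    (hf : IsAnalyticLift ρ f f₁ f₂) (hg : IsAnalyticLift ρ g g₁ g₂)
    (h₁ : ∀ z ∈ band ρ, ‖f₁ z - g₁ z‖ ≤ C) (h₂ : ∀ z ∈ band ρ, ‖f₂ z - g₂ z‖ ≤ C) (p : Torus) :
    dist (f p) (g p) ≤ C := by
  obtain ⟨⟨x⟩, ⟨y⟩⟩ := p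
  have hz : ((x : ℂ), (y : ℂ)) ∈ band ρ := by simp [band, hρ]
  change dist (f ((x : UnitAddCircle), (y : UnitAddCircle)))
    (g ((x : UnitAddCircle), (y : UnitAddCircle))) ≤ C
  rw [hf.lift, hg.lift, Prod.dist_eq]
  refine max_le ?_ ?_
  · refine (dist_coe_le _ _).trans (le_trans ?_ (h₁ _ hz))
    rw [add_sub_add_left_eq_sub, ← Complex.sub_re]
    exact Complex.abs_re_le_norm _
  · refine (dist_coe_le _ _).trans (le_trans ?_ (h₂ _ hz))
    rw [add_sub_add_left_eq_sub, ← Complex.sub_re]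
    exact Complex.abs_re_le_norm _

theorem dTilde_le {ρ C : ℝ} {f g : Torus → Torus} {f₁ f₂ g₁ g₂ : ℂ × ℂ → ℂ}
    (hf : IsAnalyticLift ρ f f₁ f₂) (hg : IsAnalyticLift ρ g g₁ g₂)
    (h₁ : ∀ z ∈ band ρ, ‖f₁ z - g₁ z‖ ≤ C) (h₂ : ∀ z ∈ band ρ, ‖f₂ z - g₂ z‖ ≤ C) :
    dTilde ρ f g ≤ ENNReal.ofReal C := by
  refine (iInf₂_le f₁ f₂).trans ((iInf_le _ hf).trans ((iInf₂_le g₁ g₂).trans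
    ((iInf_le _ hg).trans (max_le ?_ ?_))))
  · refine (iInf_le _ 0).trans (bandNorm_le_iff.2 fun z hz => ?_)
    rw [Int.cast_zero, add_zero, ← ofReal_norm]
    exact ENNReal.ofReal_le_ofReal (h₁ z hz)
  · refine (iInf_le _ 0).trans (bandNorm_le_iff.2 fun z hz => ?_)
    rw [Int.cast_zero, add_zero, ← ofReal_norm]
    exact ENNReal.ofReal_le_ofReal (h₂ z hz)

theorem exists_analyticLift_limit {ρ : ℝ} (hρ : 0 < ρ) {F : ℕ → Torus → Torus}
    (h : ∀ n, LiftsWithin ρ ((1 / 2) ^ n) (F n) (F (n + 1))) :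
    ∃ f : Torus → Torus, (∃ f₁ f₂, IsAnalyticLift ρ f f₁ f₂) ∧
      (∀ n x, dist (F n x) (f x) ≤ 2 * (1 / 2) ^ n) ∧
      ∀ n, dTilde ρ (F n) f ≤ ENNReal.ofReal (2 * (1 / 2) ^ n) := by
  choose a₁ a₂ b₁ b₂ ha hb h1 h2 using h
  set U₁ : ℕ → ℂ × ℂ → ℂ := fun n => Nat.rec (a₁ 0) (fun n u z => u z + (b₁ n z - a₁ n z)) n
  set U₂ : ℕ → ℂ × ℂ → ℂ := fun n => Nat.rec (a₂ 0) (fun n u z => u z + (b₂ n z - a₂ n z)) n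
  have hU (n : ℕ) : IsAnalyticLift ρ (F n) (U₁ n) (U₂ n) := by
    induction n with
    | zero => exact ha 0
    | succ n ih => exact ih.add_sub (ha n) (hb n)
  have e1 (n : ℕ) (z) (hz : z ∈ band ρ) : ‖U₁ (n + 1) z - U₁ n z‖ ≤ (1 / 2) ^ n := by
    have : U₁ (n + 1) z - U₁ n z = b₁ n z - a₁ n z := add_sub_cancel_left _ _
    rw [this]
    exact h1 n z hz
  have e2 (n : ℕ) (z) (hz : z ∈ band ρ) : ‖U₂ (n + 1) z - U₂ n z‖ ≤ (1 / 2) ^ n := by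
    have : U₂ (n + 1) z - U₂ n z = b₂ n z - a₂ n z := add_sub_cancel_left _ _
    rw [this]
    exact h2 n z hz
  obtain ⟨v₁, hv₁, d₁⟩ := exists_isCOmega_limit hρ (fun n => (hU n).fst_mem) e1
  obtain ⟨v₂, hv₂, d₂⟩ := exists_isCOmega_limit hρ (fun n => (hU n).snd_mem) e2
  have hgeo : Tendsto (fun n : ℕ => 2 * (1 / 2 : ℝ) ^ n) atTop (𝓝 0) := by
    simpa using (tendsto_pow_atTop_nhds_zero_of_lt_one (by norm_num : (0 : ℝ) ≤ 1 / 2)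
      (by norm_num)).const_mul 2
  have hlim (x y : ℝ) : Tendsto (fun n => F n ((x : UnitAddCircle), (y : UnitAddCircle))) atTop
      (𝓝 (((x + (v₁ ((x : ℂ), (y : ℂ))).re : ℝ) : UnitAddCircle),
        ((y + (v₂ ((x : ℂ), (y : ℂ))).re : ℝ) : UnitAddCircle))) := by
    have hz : ((x : ℂ), (y : ℂ)) ∈ band ρ := by simp [band, hρ]
    refine tendsto_iff_dist_tendsto_zero.2 (squeeze_zero (fun _ => dist_nonneg) (fun n => ?_) hgeo)
    rw [(hU n).lift, Prod.dist_eq]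
    refine max_le ?_ ?_
    · refine (dist_coe_le _ _).trans (le_trans ?_ (d₁ n _ hz))
      rw [add_sub_add_left_eq_sub, ← Complex.sub_re]
      exact Complex.abs_re_le_norm _
    · refine (dist_coe_le _ _).trans (le_trans ?_ (d₂ n _ hz))
      rw [add_sub_add_left_eq_sub, ← Complex.sub_re]
      exact Complex.abs_re_le_norm _
  have hex (p : Torus) : ∃ l, Tendsto (fun n => F n p) atTop (𝓝 l) := by
    obtain ⟨⟨x⟩, ⟨y⟩⟩ := p
    exact ⟨_, hlim x y⟩
  choose f hf using hex
  have hlift : IsAnalyticLift ρ f v₁ v₂ :=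
    ⟨hv₁, hv₂, fun x y => tendsto_nhds_unique (hf _) (hlim x y)⟩
  exact ⟨f, ⟨v₁, v₂, hlift⟩, fun n => (hU n).dist_le hρ hlift (d₁ n) (d₂ n),
    fun n => dTilde_le (hU n) hlift (d₁ n) (d₂ n)⟩

/-- Maps and inverses converge uniformly, so the two limits are mutually inverse homeomorphisms. The
shift `m` allows for uncontrolled initial terms. -/
theorem exists_diffOmega_limit {ρ : ℝ} (hρ : 0 < ρ) {S : ℕ → Torus ≃ₜ Torus} {m : ℕ}
    (pS : ∀ n, PreservesVolume (S n))
    (h : ∀ n, LiftsWithin ρ ((1 / 2) ^ n) (S (n + m)) (S (n + 1 + m)))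
    (h' : ∀ n, LiftsWithin ρ ((1 / 2) ^ n) (S (n + m)).symm (S (n + 1 + m)).symm) :
    ∃ f ∈ DiffOmega ρ, Tendsto (fun n => dRho ρ (S n) f) atTop (𝓝 0) ∧
      ∀ x, Tendsto (fun n => S n x) atTop (𝓝 (f x)) := by
  obtain ⟨f, hf, df, tf⟩ := exists_analyticLift_limit hρ (F := fun n => S (n + m)) h
  obtain ⟨g, hg, dg, tg⟩ := exists_analyticLift_limit hρ (F := fun n => (S (n + m)).symm) h'
  have hgeo : Tendsto (fun n : ℕ => 2 * (1 / 2 : ℝ) ^ n) atTop (𝓝 0) := by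
    simpa using (tendsto_pow_atTop_nhds_zero_of_lt_one (by norm_num : (0 : ℝ) ≤ 1 / 2)
      (by norm_num)).const_mul 2
  have unif {F : ℕ → Torus → Torus} {f : Torus → Torus}
      (d : ∀ n x, dist (F n x) (f x) ≤ 2 * (1 / 2) ^ n) : TendstoUniformly F f atTop := by
    rw [Metric.tendstoUniformly_iff]
    intro ε hε
    filter_upwards [hgeo.eventually (gt_mem_nhds hε)] with n hn x
    rw [dist_comm]
    exact (d n x).trans_lt hn
  have uf := unif df
  have ug := unif dg
  have cf : Continuous f := uf.continuous (.of_forall fun n => (S (n + m)).continuous)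
  have cg : Continuous g := ug.continuous (.of_forall fun n => (S (n + m)).symm.continuous)
  have hfg (x : Torus) : f (g x) = x := by
    refine tendsto_nhds_unique
      (uf.tendsto_comp (cf.continuousAt (x := g x)) (ug.tendsto_at x)) ?_
    simp
  have hgf (x : Torus) : g (f x) = x := by
    refine tendsto_nhds_unique
      (ug.tendsto_comp (cg.continuousAt (x := f x)) (uf.tendsto_at x)) ?_
    simp
  let e : Torus ≃ₜ Torus :=
    { toFun := f, invFun := g, left_inv := hgf, right_inv := hfg,
      continuous_toFun := cf, continuous_invFun := cg }
  have hlim (x : Torus) : Tendsto (fun n => S n x) atTop (𝓝 (f x)) :=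
    (tendsto_add_atTop_iff_nat m).1 (uf.tendsto_at x)
  refine ⟨e, ⟨preservesVolume_of_tendsto_ae pS cf.measurable (.of_forall hlim), hf, hg⟩, ?_, hlim⟩
  rw [← tendsto_add_atTop_iff_nat m]
  have hgeo' : Tendsto (fun n : ℕ => ENNReal.ofReal (2 * (1 / 2 : ℝ) ^ n)) atTop (𝓝 0) := by
    simpa using ENNReal.tendsto_ofReal hgeo
  exact tendsto_of_tendsto_of_tendsto_of_le_of_le tendsto_const_nhds hgeo' (fun _ => zero_le)
    fun n => max_le (tf n) (tg n)

end

noncomputable section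

/-! ### The sequence of diffeomorphisms attached to an AbC construction -/

/-- Some diffeomorphism `g` with `IsApproximant δ ε N s q h H G g`. -/
def approximant (δ ε : ℝ) (N s q : ℕ) (h H : Equiv.Perm Torus) (G : Torus ≃ₜ Torus) :
    Torus ≃ₜ Torus :=
  Classical.epsilon fun g => IsApproximant δ ε N s q h H G g

/-- Data `(q, s, H, G)` of a stage of the construction: `H` is the composite of the given
permutations, and `G` that of the approximating diffeomorphisms. -/
abbrev Stage : Type := ℕ × ℕ × Equiv.Perm Torus × (Torus ≃ₜ Torus)

/-- The composite of the first `n + 1` approximating diffeomorphisms, in terms of stage `n`. -/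
def nextComposite (ε : ℕ → ℝ) (n k s : ℕ) (z : Stage) (h : Equiv.Perm Torus) : Torus ≃ₜ Torus :=
  approximant ((1 / 2) ^ n) (ε (n + 1)) (k * z.1) s z.1 h z.2.2.1 z.2.2.2 * z.2.2.2

/-- All that can follow the stages in `F`, except that `q` is not yet updated. -/
def nextStages (ε : ℕ → ℝ) (n k : ℕ) (F : Set Stage) : Set Stage :=
  ⋃ z ∈ F, ⋃ s ∈ Set.Iic (z.2.1 ^ k),
    ⋃ h ∈ {h | 0 < k * z.1 ∧ 0 < s ∧ IsGridPermutation (k * z.1) s h},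
      {(z.1, s, h * z.2.2.1, nextComposite ε n k s z h)}

/-- All the possible stages of the constructions with parameters `k`, `l` and `q₀, s₀ ≤ m`. -/
def stages (ε : ℕ → ℝ) (k l : ℕ → ℕ) (m : ℕ) : ℕ → Set Stage
  | 0 => Set.Iic m ×ˢ Set.Iic m ×ˢ {1} ×ˢ {1}
  | n + 1 => (fun z => (k n * l n * z.1 ^ 2, z.2)) '' nextStages ε n (k n) (stages ε k l m n)

theorem finite_nextStages (ε : ℕ → ℝ) (n k : ℕ) {F : Set Stage} (hF : F.Finite) :
    (nextStages ε n k F).Finite := by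
  refine hF.biUnion fun z _ => (Set.finite_Iic _).biUnion fun s _ =>
    Set.Finite.biUnion ?_ fun _ _ => Set.finite_singleton _
  by_cases h : 0 < k * z.1 ∧ 0 < s
  · exact (finite_isGridPermutation h.1 h.2).subset fun g hg => hg.2.2
  · exact Set.finite_empty.subset fun g hg => h ⟨hg.1, hg.2.1⟩

theorem finite_stages (ε : ℕ → ℝ) (k l : ℕ → ℕ) (m n : ℕ) : (stages ε k l m n).Finite := by
  induction n with
  | zero => exact (Set.finite_Iic _).prod ((Set.finite_Iic _).prod
      ((Set.finite_singleton _).prod (Set.finite_singleton _)))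
  | succ n ih => exact (finite_nextStages ε n (k n) ih).image _

/-- This is what confines the bound on `l n` to the parameters it is allowed to see. The next
composite needs `k n` but not `l n`, since `l n` enters only through the update of `q`. -/
theorem stages_congr (ε : ℕ → ℝ) {k l k' l' : ℕ → ℕ} (m : ℕ) {n : ℕ} (hk : ∀ i < n, k i = k' i)
    (hl : ∀ i < n, l i = l' i) : stages ε k l m n = stages ε k' l' m n := by
  induction n with
  | zero => rfl
  | succ n ih =>
    rw [stages, stages, ih (fun i hi => hk i (hi.trans n.lt_succ_self))
      (fun i hi => hl i (hi.trans n.lt_succ_self)), hk n n.lt_succ_self, hl n n.lt_succ_self]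

namespace UntwistedAbC

variable {k l : ℕ → ℕ} (A : UntwistedAbC k l) (ε : ℕ → ℝ)

/-- The composites of the approximating diffeomorphisms. -/
def diffeoComposite : ℕ → Torus ≃ₜ Torus
  | 0 => 1
  | n + 1 => nextComposite ε n (k n) (A.s (n + 1))
      (A.q n, A.s n, composite A.h n, diffeoComposite n) (A.h (n + 1))

/-- The approximating diffeomorphisms. -/
def diffeo : ℕ → Torus ≃ₜ Torus
  | 0 => 1
  | n + 1 => approximant ((1 / 2) ^ n) (ε (n + 1)) (k n * A.q n) (A.s (n + 1)) (A.q n)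
      (A.h (n + 1)) (composite A.h n) (A.diffeoComposite ε n)

theorem composite_diffeo (n : ℕ) : composite (A.diffeo ε) n = A.diffeoComposite ε n := by
  induction n with
  | zero => rfl
  | succ n ih =>
    rw [composite, ih]
    rfl

theorem q_pos (n : ℕ) : 0 < A.q n := by
  induction n with
  | zero => exact A.q_zero_pos
  | succ n ih =>
    rw [A.q_succ]
    have := A.k_pos n
    have := A.l_pos n
    positivity

theorem mem_nextStages {m n : ℕ}
    (h : (A.q n, A.s n, composite A.h n, A.diffeoComposite ε n) ∈ stages ε k l m n) :
    (A.q n, A.s (n + 1), composite A.h (n + 1), A.diffeoComposite ε (n + 1)) ∈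
      nextStages ε n (k n) (stages ε k l m n) :=
  Set.mem_iUnion₂.2 ⟨_, h, Set.mem_iUnion₂.2 ⟨_, A.s_succ_le n, Set.mem_iUnion₂.2
    ⟨_, ⟨Nat.mul_pos (A.k_pos n) (A.q_pos n), A.s_pos _, A.h_grid n⟩, rfl⟩⟩⟩

theorem mem_stages {m : ℕ} (hq : A.q 0 ≤ m) (hs : A.s 0 ≤ m) (n : ℕ) :
    (A.q n, A.s n, composite A.h n, A.diffeoComposite ε n) ∈ stages ε k l m n := by
  induction n with
  | zero => exact ⟨hq, hs, rfl, rfl⟩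
  | succ n ih => exact ⟨_, A.mem_nextStages ε ih, by rw [A.q_succ]⟩

theorem h_mem_approxGroup (n : ℕ) : A.h (n + 1) ∈ approxGroup (A.q n) :=
  (A.h_grid n).mem_approxGroup (A.k_pos n) (A.s_pos _) (A.q_pos n) (A.h_comm n) (A.h_untwisted n)

theorem preservesVolume_composite (n : ℕ) :
    PreservesVolume (composite A.h n : Equiv.Perm Torus) ∧ Measurable (composite A.h n).symm := by
  induction n with
  | zero => exact ⟨MeasurePreserving.id _, measurable_id⟩
  | succ n ih =>
    obtain ⟨h1, h2, -⟩ := A.h_mem_approxGroup n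
    exact ⟨h1.comp ih.1, ih.2.comp h2⟩

variable {ε}

/-- The choice operator is meaningful only if an approximant exists, which needs the previous
composite to preserve volume; membership in `entireGroup` is therefore carried along by induction.
-/
theorem isApproximant_of_mem (hε : ∀ n, 0 < ε n) {n : ℕ}
    (hG : A.diffeoComposite ε n ∈ entireGroup) :
    IsApproximant ((1 / 2) ^ n) (ε (n + 1)) (k n * A.q n) (A.s (n + 1)) (A.q n) (A.h (n + 1))
      (composite A.h n) (A.diffeoComposite ε n) (A.diffeo ε (n + 1)) :=
  Classical.epsilon_spec (exists_isApproximant (by positivity) (hε _)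
    (Nat.mul_pos (A.k_pos n) (A.q_pos n)) (A.s_pos _) (A.h_mem_approxGroup n) (A.h_grid n)
    (A.preservesVolume_composite n).1 (A.preservesVolume_composite n).2 hG.1)

theorem diffeoComposite_mem (hε : ∀ n, 0 < ε n) (n : ℕ) :
    A.diffeoComposite ε n ∈ entireGroup := by
  induction n with
  | zero => exact one_mem _
  | succ n ih => exact mul_mem (A.isApproximant_of_mem hε ih).mem.1 ih

theorem isApproximant (hε : ∀ n, 0 < ε n) (n : ℕ) :
    IsApproximant ((1 / 2) ^ n) (ε (n + 1)) (k n * A.q n) (A.s (n + 1)) (A.q n) (A.h (n + 1))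
      (composite A.h n) (A.diffeoComposite ε n) (A.diffeo ε (n + 1)) :=
  A.isApproximant_of_mem hε (A.diffeoComposite_mem hε n)

theorem α_succ (n : ℕ) : A.α (n + 1) = A.α n + 1 / (k n * l n * A.q n ^ 2 : ℝ) := by
  have hk : (k n : ℝ) ≠ 0 := by exact_mod_cast (A.k_pos n).ne'
  have hl : (l n : ℝ) ≠ 0 := by exact_mod_cast (A.l_pos n).ne'
  have hq : (A.q n : ℝ) ≠ 0 := by exact_mod_cast (A.q_pos n).ne'
  rw [α, α, A.p_succ, A.q_succ]
  push_cast
  field_simp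

/-- The new factor cancels against the rotation, so consecutive conjugates can be compared with the
same conjugating map. -/
theorem conj_rot_succ {n : ℕ} {t : ℝ} (hc : Commute (A.diffeo ε (n + 1)) (rot t)) :
    (A.diffeoComposite ε n)⁻¹ * rot t * A.diffeoComposite ε n =
      (A.diffeoComposite ε (n + 1))⁻¹ * rot t * A.diffeoComposite ε (n + 1) := by
  have e : A.diffeoComposite ε (n + 1) = A.diffeo ε (n + 1) * A.diffeoComposite ε n := rfl
  have hc' : (A.diffeo ε (n + 1))⁻¹ * rot t * A.diffeo ε (n + 1) = rot t := by
    rw [mul_assoc, inv_mul_eq_iff_eq_mul]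
    exact hc.eq.symm
  rw [e, mul_inv_rev]
  conv_lhs => rw [← hc']
  simp only [mul_assoc]

end UntwistedAbC

/-! ### Lower bounds for `l n` and the size of one step -/

open Classical in
/-- A constant as in `exists_conj_rot_liftsWithin`. -/
def conjConst (ρ : ℝ) (G : Torus ≃ₜ Torus) : ℕ :=
  if h : G ∈ entireGroup then (exists_conj_rot_liftsWithin ρ h).choose else 0

theorem conjConst_spec (ρ : ℝ) {G : Torus ≃ₜ Torus} (h : G ∈ entireGroup) (s t : ℝ) (ht : |t| ≤ 1) :
    LiftsWithin ρ (conjConst ρ G * |t|) (G⁻¹ * rot s * G : Torus ≃ₜ Torus)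
      (G⁻¹ * rot (s + t) * G : Torus ≃ₜ Torus) := by
  rw [conjConst, dif_pos h]
  exact (exists_conj_rot_liftsWithin ρ h).choose_spec s t ht

/-- A lower bound for `l_n`, in terms of `k_0, …, k_n` and `l_0, …, l_{n-1}`, that makes the
`n`-th step small in `d_ρ` for all constructions with `q_0, s_0 ≤ n`. -/
def lowerBound (ρ : ℝ) (ε : ℕ → ℝ) (n : ℕ) (k l : ℕ → ℕ) : ℕ :=
  sSup ((fun z : Stage => conjConst ρ z.2.2.2 * 2 ^ n) ''
    nextStages ε n (k n) (stages ε k l n n))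

theorem le_lowerBound (ρ : ℝ) (ε : ℕ → ℝ) {n : ℕ} {k l : ℕ → ℕ} {z : Stage}
    (hz : z ∈ nextStages ε n (k n) (stages ε k l n n)) :
    conjConst ρ z.2.2.2 * 2 ^ n ≤ lowerBound ρ ε n k l :=
  le_csSup ((finite_nextStages ε n (k n) (finite_stages ε k l n n)).image _).bddAbove ⟨z, hz, rfl⟩

theorem lowerBound_congr (ρ : ℝ) (ε : ℕ → ℝ) {n : ℕ} {k l k' l' : ℕ → ℕ}
    (hk : ∀ i < n + 1, k i = k' i) (hl : ∀ i < n, l i = l' i) :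
    lowerBound ρ ε n k l = lowerBound ρ ε n k' l' := by
  rw [lowerBound, lowerBound, hk n n.lt_succ_self,
    stages_congr ε n (fun i hi => hk i (hi.trans n.lt_succ_self)) hl]

/-- Extension of a finite sequence by zero. -/
def extendZero {n : ℕ} (k : Fin n → ℕ) (i : ℕ) : ℕ := if h : i < n then k ⟨i, h⟩ else 0

theorem extendZero_apply (k : ℕ → ℕ) {n i : ℕ} (hi : i < n) :
    extendZero (fun i : Fin n => k i) i = k i := by
  rw [extendZero, dif_pos hi]

/-- The angles differ by at most $1/l_n$ and `lowerBound` dominates $2^n$ times the constant of the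
new composite. The sign `c` treats the maps and their inverses at once. -/
theorem UntwistedAbC.liftsWithin {ρ : ℝ} {ε : ℕ → ℝ} (hε : ∀ n, 0 < ε n) {k l : ℕ → ℕ}
    (A : UntwistedAbC k l) {n : ℕ} (hq : A.q 0 ≤ n) (hs : A.s 0 ≤ n)
    (hl : lowerBound ρ ε n k l ≤ l n) (c : ℝ) (hc : |c| = 1) :
    LiftsWithin ρ ((1 / 2) ^ n)
      ((A.diffeoComposite ε n)⁻¹ * rot (c * A.α n) * A.diffeoComposite ε n : Torus ≃ₜ Torus)
      ((A.diffeoComposite ε (n + 1))⁻¹ * rot (c * A.α (n + 1)) * A.diffeoComposite ε (n + 1) :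
        Torus ≃ₜ Torus) := by
  have hcomm : Commute (A.diffeo ε (n + 1)) (rot (c * A.α n)) := by
    have h := commute_rot_of_mem_entireCentralizer (A.isApproximant hε n).mem (A.p n)
    rcases eq_or_eq_neg_of_abs_eq hc with rfl | rfl
    · rwa [one_mul]
    · rw [neg_one_mul, rot_neg]
      exact h.inv_right
  set t : ℝ := 1 / (k n * l n * A.q n ^ 2 : ℝ) with ht
  have hk1 : (1 : ℝ) ≤ k n := by exact_mod_cast A.k_pos n
  have hl1 : (1 : ℝ) ≤ l n := by exact_mod_cast A.l_pos n
  have hq1 : (1 : ℝ) ≤ A.q n ^ 2 := one_le_pow₀ (by exact_mod_cast A.q_pos n)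
  have hle : (l n : ℝ) ≤ k n * l n * A.q n ^ 2 := by
    have : (1 : ℝ) ≤ k n * A.q n ^ 2 := one_le_mul_of_one_le_of_one_le hk1 hq1
    nlinarith
  have ht0 : 0 ≤ t := by positivity
  have htl : t ≤ 1 / l n := one_div_le_one_div_of_le (by positivity) hle
  have htabs : |c * t| = t := by rw [abs_mul, hc, one_mul, abs_of_nonneg ht0]
  have ht1 : |c * t| ≤ 1 := by
    rw [htabs]
    exact htl.trans ((div_le_one (by positivity)).2 hl1)
  have hC := (le_lowerBound ρ ε (A.mem_nextStages ε (A.mem_stages ε hq hs n))).trans hl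
  replace hC : (conjConst ρ (A.diffeoComposite ε (n + 1)) : ℝ) * 2 ^ n ≤ l n := by exact_mod_cast hC
  rw [A.conj_rot_succ hcomm, A.α_succ, mul_add]
  refine (conjConst_spec ρ (A.diffeoComposite_mem hε (n + 1)) _ _ ht1).mono ?_
  rw [htabs]
  calc (conjConst ρ (A.diffeoComposite ε (n + 1)) : ℝ) * t
      ≤ conjConst ρ (A.diffeoComposite ε (n + 1)) * (1 / l n) := by gcongr
    _ ≤ (1 / 2) ^ n := by
      rw [mul_one_div, one_div_pow, div_le_div_iff₀ (by positivity) (by positivity), one_mul]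
      exact hC

end

/-! ### The main theorem -/

theorem mainTheorem2 (ρ : ℝ) (hρ : 0 < ρ) (ε : ℕ → ℝ) (hε : ∀ n, 0 < ε n) (hε' : Summable ε) :
    ∃ lstar : (n : ℕ) → (Fin (n + 1) → ℕ) → (Fin n → ℕ) → ℕ,
      ∀ k l : ℕ → ℕ,
        (∀ n, lstar n (fun i => k i) (fun i => l i) ≤ l n) →
        ∀ (A : UntwistedAbC k l) (T : Torus → Torus), A.Builds T →
          ∃ (ha : ℕ → Torus ≃ₜ Torus) (Ta : Torus ≃ₜ Torus),
            (∀ n, ha (n + 1) ∈ DiffOmegaInfty ∧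
              EpsApproximates (ε (n + 1)) (k n * A.q n) (A.s (n + 1)) (A.q n)
                (ha (n + 1)) (A.h (n + 1))) ∧
            (∀ n, (composite ha n)⁻¹ * rot (A.α n) * composite ha n ∈ DiffOmega ρ) ∧
            Ta ∈ DiffOmega ρ ∧
            Tendsto (fun n => dRho ρ ((composite ha n)⁻¹ * rot (A.α n) * composite ha n) Ta)
              atTop (𝓝 0) ∧
            MeasureIsomorphic T Ta := by
  refine ⟨fun n k l => lowerBound ρ ε n (extendZero k) (extendZero l), ?_⟩
  intro k l hl A T hT
  replace hl (n : ℕ) : lowerBound ρ ε n k l ≤ l n := by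
    refine le_of_eq_of_le (lowerBound_congr ρ ε (fun i hi => ?_) (fun i hi => ?_)) (hl n)
    · exact (extendZero_apply k hi).symm
    · exact (extendZero_apply l hi).symm
  set S : ℕ → Torus ≃ₜ Torus := fun n =>
    (A.diffeoComposite ε n)⁻¹ * rot (A.α n) * A.diffeoComposite ε n with hS
  have hSmem (n : ℕ) : S n ∈ entireGroup :=
    mul_mem (mul_mem (inv_mem (A.diffeoComposite_mem hε n)) (rot_mem_entireGroup _))
      (A.diffeoComposite_mem hε n)
  have hSinv (n : ℕ) : (S n)⁻¹ =
      (A.diffeoComposite ε n)⁻¹ * rot (-1 * A.α n) * A.diffeoComposite ε n := by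
    rw [hS, neg_one_mul, rot_neg]
    group
  have hstep (c : ℝ) (hc : |c| = 1) (n : ℕ) : LiftsWithin ρ ((1 / 2) ^ n)
      ((A.diffeoComposite ε (n + max (A.q 0) (A.s 0)))⁻¹ *
        rot (c * A.α (n + max (A.q 0) (A.s 0))) *
        A.diffeoComposite ε (n + max (A.q 0) (A.s 0)) : Torus ≃ₜ Torus)
      ((A.diffeoComposite ε (n + 1 + max (A.q 0) (A.s 0)))⁻¹ *
        rot (c * A.α (n + 1 + max (A.q 0) (A.s 0))) *
        A.diffeoComposite ε (n + 1 + max (A.q 0) (A.s 0)) : Torus ≃ₜ Torus) := by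
    have := A.liftsWithin hε (n := n + max (A.q 0) (A.s 0))
      ((le_max_left _ _).trans (Nat.le_add_left _ _))
      ((le_max_right _ _).trans (Nat.le_add_left _ _)) (hl _) c hc
    rw [add_right_comm n 1]
    exact this.mono (pow_le_pow_of_le_one (by norm_num) (by norm_num) (Nat.le_add_right _ _))
  -- The bound on `l n` covers this construction only once `n` has reached both `A.q 0` and `A.s 0`;
  -- hence the shift by their maximum.
  obtain ⟨Ta, hTa, hd, hlim⟩ := exists_diffOmega_limit hρ (S := S)
    (m := max (A.q 0) (A.s 0)) (fun n => (hSmem n).1)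
    (fun n => by simpa only [one_mul] using hstep 1 (by simp) n)
    (fun n => by
      have := hstep (-1) (by simp) n
      rw [← hSinv, ← hSinv] at this
      exact this)
  refine ⟨A.diffeo ε, Ta, fun n => ⟨mem_diffOmegaInfty_of_mem_entireGroup
    (A.isApproximant hε n).mem.1, (A.isApproximant hε n).approx⟩, fun n => ?_, hTa, ?_, ?_⟩
  · rw [A.composite_diffeo]
    exact mem_diffOmega_of_mem_entireGroup (hSmem n) ρ
  · simpa only [A.composite_diffeo] using hd
  · exact measureIsomorphic_of_conj (H := fun n => composite A.h n)
      (G := fun n => A.diffeoComposite ε n) (R := fun n => rot (A.α n))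
      (fun n => (A.preservesVolume_composite n).1) (fun n => (A.preservesVolume_composite n).2)
      (fun n => (A.diffeoComposite_mem hε n).1) (fun n => preservesVolume_rot _)
      (fun n => (A.isApproximant hε n).conj) (fun n => (A.isApproximant hε n).conj_symm)
      hT.2 hTa.1 hlim
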